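/- **Setting.** All Hilbert spaces are complex, scalar products are linear in the first variable, and $\otimes$ is the Hilbert space tensor product. A positive definite kernel $K:\Lambda\times\Lambda\to\mathbb{C}$ has reproducing kernel space $\mathfrak{H}(K)$ and kernel functions $k_\lambda(\mu)=K(\mu,\lambda)$. It is a *Pick kernel* if $K(\mu,\lambda)\neq 0$ for all $\mu,\lambda$ and, for every $\lambda_0\in\Lambda$, the function $1-\frac{K(\mu,\lambda_0)K(\lambda_0,\lambda)}{K(\mu,\lambda)K(\lambda_0,\lambda_0)}$ is a positive definite kernel. Fix $\lambda_0\in\Lambda$ and put $\delta=k_{\lambda_0}/\|k_{\lambda_0}\|$. Then there are a Hilbert space $\mathcal{B}$ and a function $\beta:\Lambda\to\mathcal{B}$, whose values span a dense subspace, with $$K(\mu,\lambda)=\frac{\delta(\mu)\overline{\delta(\lambda)}}{1-\langle\beta(\lambda),\beta(\mu)\rangle};$$ they are unique up to a unitary, and we fix any such pair. Let $K'(\mu,\lambda)=\frac{K(\mu,\lambda)}{\delta(\mu)\overline{\delta(\lambda)}}$; then $\Omega f=f/\delta$ is a unitary from $\mathfrak{H}(K)$ onto $\mathfrak{H}(K')$.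 For a Hilbert space $\mathcal{G}$ we also write $\Omega$ for $\Omega\otimes I_{\mathcal{G}}:\mathfrak{H}(K)\otimes\mathcal{G}\to\mathfrak{H}(K')\otimes\mathcal{G}$. Let $\boldsymbol{B}:\mathcal{B}\otimes\mathfrak{H}(K')\to\mathfrak{H}(K')$ be the contraction given by $\boldsymbol{B}(\xi\otimes f)(\lambda)=\langle\xi,\beta(\lambda)\rangle f(\lambda)$. A Hilbert space $\mathcal{N}$ is *contractively included* in a Hilbert space $\mathcal{H}$ if it is a vector subspace of $\mathcal{H}$ and $\|x\|_{\mathcal{H}}\le\|x\|_{\mathcal{N}}$ on $\mathcal{N}$. The *complementary subspace* $\mathcal{M}^\sharp$ of a contractively included $\mathcal{M}$ is the unique contractively included Hilbert space such that $\|x+y\|^2_{\mathcal H}\le\|x\|_{\mathcal{M}}^2+\|y\|_{\mathcal{M}^\sharp}^2$ for all $x\in\mathcal{M}$, $y\in\mathcal{M}^\sharp$, and every $z\in\mathcal{H}$ has a unique decomposition $z=x+y$ with $x\in\mathcal{M}$, $y\in\mathcal{M}^\sharp$ and $\|z\|^2_{\mathcal H}=\|x\|_{\mathcal{M}}^2+\|y\|_{\mathcal{M}^\sharp}^2$.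 A function $G:\Lambda\to\mathcal{L}(\mathcal{G}',\mathcal{G})$ is a *contractive multiplier* of $\mathfrak{H}(K)$ if there is a contraction $\mathfrak{m}_G:\mathfrak{H}(K)\otimes\mathcal{G}'\to\mathfrak{H}(K)\otimes\mathcal{G}$ with $\mathfrak{m}_G^*(k_\lambda\otimes y)=k_\lambda\otimes G(\lambda)^*y$ for all $\lambda\in\Lambda$, $y\in\mathcal{G}$; then $\mathcal{M}_G$ denotes the range of $\mathfrak{m}_G$ with the norm $\|x\|=\inf\{\|y\|:\mathfrak{m}_Gy=x\}$. **Theorem.** Let $K$ be a Pick kernel on $\Lambda$, let $\mathcal{G}$ be a Hilbert space, and let $\mathcal{N}$ be contractively included in $\mathfrak{H}(K)\otimes\mathcal{G}$. Let $\Omega\mathcal{N}\subset\mathfrak{H}(K')\otimes\mathcal{G}$ carry the norm $\|\Omega\xi\|_{\Omega\mathcal{N}}=\|\xi\|_{\mathcal{N}}$. The following are equivalent: (i) There are a Hilbert space $\mathcal{G}'$ and a contractive multiplier $G:\Lambda\to\mathcal{L}(\mathcal{G}',\mathcal{G})$ of $\mathfrak{H}(K)$ such that $\mathcal{N}=\mathcal{M}_G^\sharp$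 (with equality of norms). (ii) There is a linear contraction $\tilde{\boldsymbol{B}}:\Omega\mathcal{N}\to\mathcal{B}\otimes\Omega\mathcal{N}$ such that for all $\xi\in\mathcal{N}$ $$\Omega\xi=(\boldsymbol{B}\otimes I_{\mathcal{G}})\tilde{\boldsymbol{B}}\Omega\xi+(\pi'\otimes I_{\mathcal{G}})\Omega\xi,$$ $$\|\tilde{\boldsymbol{B}}\Omega\xi\|^2_{\mathcal{B}\otimes\Omega\mathcal{N}}\le\|\Omega\xi\|^2_{\Omega\mathcal{N}}-\|(\pi'\otimes I_{\mathcal{G}})\Omega\xi\|^2_{\mathfrak{H}(K')\otimes\mathcal{G}},$$ where $\pi'$ is the orthogonal projection of $\mathfrak{H}(K')$ onto the constant functions. In the first relation $\mathcal{B}\otimes\Omega\mathcal{N}$ is mapped into $\mathcal{B}\otimes\mathfrak{H}(K')\otimes\mathcal{G}$ by $I_{\mathcal{B}}$ tensored with the inclusion. -/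

import Mathlib

open scoped TensorProduct ComplexOrder ComplexConjugate InnerProductSpace

universe u

noncomputable section

/-! ### Hilbert space tensor products -/

section HilbertTensor

variable (E F : Type*) [NormedAddCommGroup E] [InnerProductSpace ℂ E]
  [NormedAddCommGroup F] [InnerProductSpace ℂ F]

/-- The Hilbert space tensor product of `E` and `F`: the completion of the algebraic tensor
product for the inner product with `⟪x ⊗ y, x' ⊗ y'⟫ = ⟪x, x'⟫ * ⟪y, y'⟫`. -/
def HTensor : Type _ := UniformSpace.Completion (E ⊗[ℂ] F)

instance : NormedAddCommGroup (HTensor E F) :=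
  inferInstanceAs (NormedAddCommGroup (UniformSpace.Completion (E ⊗[ℂ] F)))

instance : InnerProductSpace ℂ (HTensor E F) :=
  inferInstanceAs (InnerProductSpace ℂ (UniformSpace.Completion (E ⊗[ℂ] F)))

instance : CompleteSpace (HTensor E F) :=
  inferInstanceAs (CompleteSpace (UniformSpace.Completion (E ⊗[ℂ] F)))

infixl:100 " ⊗ₕ " => HTensor

namespace HTensor

/-- The inclusion of the algebraic tensor product. -/
def incl : E ⊗[ℂ] F →ₗᵢ[ℂ] E ⊗ₕ F := UniformSpace.Completion.toComplₗᵢ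

theorem denseRange_incl : DenseRange (incl E F) := UniformSpace.Completion.denseRange_coe

variable {E F}

/-- Simple tensors. -/
def tmul (x : E) (y : F) : E ⊗ₕ F := incl E F (x ⊗ₜ[ℂ] y)

theorem inner_tmul (x x' : E) (y y' : F) :
    ⟪tmul x y, tmul x' y'⟫_ℂ = ⟪x, x'⟫_ℂ * ⟪y, y'⟫_ℂ := by
  simp [tmul]

variable {E' F' : Type*} [NormedAddCommGroup E'] [InnerProductSpace ℂ E']
  [NormedAddCommGroup F'] [InnerProductSpace ℂ F']

/-- The tensor product `S ⊗ T` of two bounded operators. -/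
def map (S : E →L[ℂ] E') (T : F →L[ℂ] F') : E ⊗ₕ F →L[ℂ] E' ⊗ₕ F' :=
  ((incl E' F').toContinuousLinearMap ∘L TensorProduct.mapL S T).extend
    (incl E F).toContinuousLinearMap

theorem map_tmul (S : E →L[ℂ] E') (T : F →L[ℂ] F') (x : E) (y : F) :
    map S T (tmul x y) = tmul (S x) (T y) :=
  ContinuousLinearMap.extend_eq _ (denseRange_incl E F)
    (incl E F).isometry.isUniformInducing (x ⊗ₜ[ℂ] y)

/-- The unitary `U ⊗ I` for a unitary `U`. -/
def congrLeft (U : E ≃ₗᵢ[ℂ] E') (F : Type*) [NormedAddCommGroup F] [InnerProductSpace ℂ F] :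
    E ⊗ₕ F ≃ₗᵢ[ℂ] E' ⊗ₕ F :=
  (U.rTensor F).toLinearEquiv.extendOfIsometry
    (incl E F).toLinearMap (incl E' F).toLinearMap (denseRange_incl E F) (denseRange_incl E' F)
    (fun x => by
      simp only [LinearIsometry.coe_toLinearMap, LinearIsometryEquiv.coe_toLinearEquiv,
        LinearIsometry.norm_map, LinearIsometryEquiv.norm_map])

theorem congrLeft_tmul (U : E ≃ₗᵢ[ℂ] E') (x : E) (y : F) :
    congrLeft U F (tmul x y) = tmul (U x) y :=
  LinearEquiv.extendOfIsometry_eq _ _ _ (denseRange_incl E F) (denseRange_incl E' F)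
    (fun x => by
      simp only [LinearIsometry.coe_toLinearMap, LinearIsometryEquiv.coe_toLinearEquiv,
        LinearIsometry.norm_map, LinearIsometryEquiv.norm_map]) (x ⊗ₜ[ℂ] y)

theorem denseRange_incl_of_denseRange {E₁ F₁ : Type*} [NormedAddCommGroup E₁]
    [InnerProductSpace ℂ E₁] [NormedAddCommGroup F₁] [InnerProductSpace ℂ F₁]
    (S : E₁ →ₗᵢ[ℂ] E) (hS : DenseRange S) (T : F₁ →ₗᵢ[ℂ] F) (hT : DenseRange T) :
    DenseRange ((incl E F).comp (TensorProduct.mapIsometry S T)) := by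
  refine (denseRange_incl E F).comp ?_ (incl E F).continuous
  have key : ∀ z : E ⊗[ℂ] F,
      z ∈ (LinearMap.range (TensorProduct.mapIsometry S T).toLinearMap).topologicalClosure := by
    intro z
    induction z using TensorProduct.induction_on with
    | zero => exact zero_mem _
    | add a b ha hb => exact add_mem ha hb
    | tmul x y =>
      have hd : DenseRange (Prod.map S T) := hS.prodMap hT
      refine hd.induction_on (p := fun w : E × F => w.1 ⊗ₜ[ℂ] w.2 ∈
        (LinearMap.range (TensorProduct.mapIsometry S T).toLinearMap).topologicalClosure)
        (x, y) ?_ ?_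
      · exact (Submodule.isClosed_topologicalClosure _).preimage
          (TensorProduct.continuous_tmul (𝕜 := ℂ) (E := E) (F := F))
      · rintro ⟨a, b⟩
        exact Submodule.le_topologicalClosure _ ⟨a ⊗ₜ b, by simp⟩
  intro z
  exact key z

/-- The canonical unitary identifying `E ⊗ (F ⊗ G)` with `(E ⊗ F) ⊗ G`. -/
def assoc (E F G : Type*) [NormedAddCommGroup E] [InnerProductSpace ℂ E]
    [NormedAddCommGroup F] [InnerProductSpace ℂ F] [NormedAddCommGroup G]
    [InnerProductSpace ℂ G] : E ⊗ₕ (F ⊗ₕ G) ≃ₗᵢ[ℂ] (E ⊗ₕ F) ⊗ₕ G :=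
  (TensorProduct.assocIsometry ℂ E F G).symm.toLinearEquiv.extendOfIsometry
    ((incl E (F ⊗ₕ G)).comp
      (TensorProduct.mapIsometry LinearIsometry.id (incl F G))).toLinearMap
    ((incl (E ⊗ₕ F) G).comp
      (TensorProduct.mapIsometry (incl E F) LinearIsometry.id)).toLinearMap
    (denseRange_incl_of_denseRange _ denseRange_id _ (denseRange_incl F G))
    (denseRange_incl_of_denseRange _ (denseRange_incl E F) _ denseRange_id)
    (fun x => by
      simp only [LinearIsometry.coe_toLinearMap, LinearIsometryEquiv.coe_toLinearEquiv,
        LinearIsometry.norm_map, LinearIsometryEquiv.norm_map])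

theorem assoc_tmul {G : Type*} [NormedAddCommGroup G] [InnerProductSpace ℂ G]
    (x : E) (y : F) (z : G) :
    assoc E F G (tmul x (tmul y z)) = tmul (tmul x y) z :=
  LinearEquiv.extendOfIsometry_eq (TensorProduct.assocIsometry ℂ E F G).symm.toLinearEquiv
    ((incl E (F ⊗ₕ G)).comp
      (TensorProduct.mapIsometry LinearIsometry.id (incl F G))).toLinearMap
    ((incl (E ⊗ₕ F) G).comp
      (TensorProduct.mapIsometry (incl E F) LinearIsometry.id)).toLinearMap
    (denseRange_incl_of_denseRange _ denseRange_id _ (denseRange_incl F G))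
    (denseRange_incl_of_denseRange _ (denseRange_incl E F) _ denseRange_id)
    (fun x => by
      simp only [LinearIsometry.coe_toLinearMap, LinearIsometryEquiv.coe_toLinearEquiv,
        LinearIsometry.norm_map, LinearIsometryEquiv.norm_map]) (x ⊗ₜ[ℂ] (y ⊗ₜ[ℂ] z))

end HTensor

end HilbertTensor

/-! ### Contractively included subspaces -/

/-- A contractively included subspace of the Hilbert space `H`: a Hilbert space `Space` with an
injective linear contraction `incl` into `H`, by which its elements are regarded as elements
of `H`. -/
structure ContractiveSubspace (H : Type u) [NormedAddCommGroup H] [InnerProductSpace ℂ H] where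
  Space : Type u
  [normed : NormedAddCommGroup Space]
  [innerProd : InnerProductSpace ℂ Space]
  [complete : CompleteSpace Space]
  incl : Space →L[ℂ] H
  injective : Function.Injective incl
  norm_incl_le : ∀ x, ‖incl x‖ ≤ ‖x‖

namespace ContractiveSubspace

attribute [instance] normed innerProd complete

variable {H H' : Type u} [NormedAddCommGroup H] [InnerProductSpace ℂ H]
  [NormedAddCommGroup H'] [InnerProductSpace ℂ H']

/-- The image of a contractively included subspace under a unitary of the ambient spaces, with
the norm `‖U x‖ = ‖x‖`. -/
def image (N : ContractiveSubspace H) (U : H ≃ₗᵢ[ℂ] H') : ContractiveSubspace H' where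
  Space := N.Space
  incl := (U : H →L[ℂ] H') ∘L N.incl
  injective := U.injective.comp N.injective
  norm_incl_le x := by simpa using N.norm_incl_le x

/-- The map `x ↦ U x` from `N` onto its image under `U`. -/
def toImage (N : ContractiveSubspace H) (U : H ≃ₗᵢ[ℂ] H') :
    N.Space ≃ₗᵢ[ℂ] (N.image U).Space :=
  LinearIsometryEquiv.refl ℂ N.Space

theorem incl_toImage (N : ContractiveSubspace H) (U : H ≃ₗᵢ[ℂ] H') (x : N.Space) :
    (N.image U).incl (N.toImage U x) = U (N.incl x) := rfl

/-- The range space of a contraction `C : E → H`: its elements are those of the range of `C`.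
It is realised on `(ker C)ᗮ`, which `C` maps unitarily onto the range; see `norm_range`. -/
def range {E : Type u} [NormedAddCommGroup E] [InnerProductSpace ℂ E] [CompleteSpace E]
    (C : E →L[ℂ] H) (hC : ‖C‖ ≤ 1) : ContractiveSubspace H where
  Space := ↥((LinearMap.ker C.toLinearMap)ᗮ)
  normed := inferInstance
  innerProd := inferInstance
  complete := inferInstance
  incl := C ∘L (LinearMap.ker C.toLinearMap)ᗮ.subtypeL
  injective := by
    refine (injective_iff_map_eq_zero _).2 fun x hx => ?_
    have h1 : (x : E) ∈ LinearMap.ker C.toLinearMap := hx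
    exact Subtype.ext (inner_self_eq_zero (𝕜 := ℂ).1
      (Submodule.inner_right_of_mem_orthogonal h1 x.2))
  norm_incl_le x := C.le_of_opNorm_le hC (x : E) |>.trans_eq (one_mul _)

/-- The elements of the range space are those of the range of `C`. -/
theorem range_range {E : Type u} [NormedAddCommGroup E] [InnerProductSpace ℂ E]
    [CompleteSpace E] (C : E →L[ℂ] H) (hC : ‖C‖ ≤ 1) :
    Set.range (range C hC).incl = Set.range C := by
  apply Set.Subset.antisymm
  · rintro _ ⟨x, rfl⟩
    let x' : ↥((LinearMap.ker C.toLinearMap)ᗮ) := x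
    exact ⟨(x' : E), rfl⟩
  · rintro _ ⟨y, rfl⟩
    have hcl : IsClosed (LinearMap.ker C.toLinearMap : Set E) := C.isClosed_ker
    have : CompleteSpace (LinearMap.ker C.toLinearMap) := hcl.completeSpace_coe
    refine ⟨⟨y - (LinearMap.ker C.toLinearMap).starProjection y,
      Submodule.sub_starProjection_mem_orthogonal y⟩, ?_⟩
    have h0 : C ((LinearMap.ker C.toLinearMap).starProjection y) = 0 :=
      LinearMap.mem_ker.1 (Submodule.starProjection_apply_mem _ y)
    change C (y - (LinearMap.ker C.toLinearMap).starProjection y) = C y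
    rw [map_sub, h0, sub_zero]

/-- The norm of the range space is `‖x‖ = inf {‖y‖ : C y = x}`. -/
theorem norm_range {E : Type u} [NormedAddCommGroup E] [InnerProductSpace ℂ E]
    [CompleteSpace E] (C : E →L[ℂ] H) (hC : ‖C‖ ≤ 1) (x : (range C hC).Space) :
    IsLeast {r : ℝ | ∃ y : E, C y = (range C hC).incl x ∧ ‖y‖ = r} ‖x‖ := by
  let x' : ↥((LinearMap.ker C.toLinearMap)ᗮ) := x
  refine ⟨⟨(x' : E), rfl, rfl⟩, ?_⟩
  rintro r ⟨y, hy, rfl⟩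
  have hy' : C y = C (x' : E) := hy
  have hk : y - (x' : E) ∈ LinearMap.ker C.toLinearMap := by
    rw [LinearMap.mem_ker]; simp [hy']
  have ho : ⟪y - (x' : E), (x' : E)⟫_ℂ = 0 :=
    Submodule.inner_right_of_mem_orthogonal hk x'.2
  have hp := norm_add_sq_eq_norm_sq_add_norm_sq_of_inner_eq_zero _ _ ho
  rw [sub_add_cancel] at hp
  change ‖(x' : E)‖ ≤ ‖y‖
  nlinarith [norm_nonneg y, norm_nonneg (x' : E), mul_self_nonneg ‖y - (x' : E)‖]

/-- `N` is the complementary subspace of `M`. -/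
structure IsComplement (M N : ContractiveSubspace H) : Prop where
  norm_add_sq_le : ∀ (x : M.Space) (y : N.Space),
    ‖M.incl x + N.incl y‖ ^ 2 ≤ ‖x‖ ^ 2 + ‖y‖ ^ 2
  existsUnique_decomposition : ∀ z : H, ∃! p : M.Space × N.Space,
    z = M.incl p.1 + N.incl p.2 ∧ ‖z‖ ^ 2 = ‖p.1‖ ^ 2 + ‖p.2‖ ^ 2

end ContractiveSubspace

/-! ### Operators defined on total families -/

section Gram

variable {ι E F : Type*} [NormedAddCommGroup E] [InnerProductSpace ℂ E]
  [NormedAddCommGroup F] [InnerProductSpace ℂ F]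

theorem sum_gram (a : ι → E) (c : ι →₀ ℂ) :
    (c.sum fun i x => c.sum fun j y => star x * ⟪a i, a j⟫_ℂ * y) =
      ((‖Finsupp.linearCombination ℂ a c‖ ^ 2 : ℝ) : ℂ) := by
  have h := inner_self_eq_norm_sq_to_K (𝕜 := ℂ) (Finsupp.linearCombination ℂ a c)
  push_cast
  rw [← Complex.coe_algebraMap] at *
  rw [← RCLike.algebraMap_eq_ofReal] at h
  refine Eq.trans ?_ h
  rw [Finsupp.linearCombination_apply, Finsupp.sum_inner]
  simp only [Finsupp.inner_sum, inner_smul_left, inner_smul_right]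
  refine Finsupp.sum_congr fun i _ => Finsupp.sum_congr fun j _ => ?_
  simp only [RCLike.star_def]
  ring

theorem posSemidef_of_gram (a : ι → E) :
    (Matrix.of fun i j => ⟪a i, a j⟫_ℂ).PosSemidef := by
  refine ⟨?_, fun c => ?_⟩
  · ext i j
    simp [Matrix.conjTranspose_apply]
  · simp only [Matrix.of_apply]
    rw [sum_gram]
    exact Complex.zero_le_real.2 (sq_nonneg _)

theorem norm_le_of_posSemidef (a : ι → E) (b : ι → F)
    (h : (Matrix.of fun i j => ⟪a i, a j⟫_ℂ - ⟪b i, b j⟫_ℂ).PosSemidef) (c : ι →₀ ℂ) :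
    ‖Finsupp.linearCombination ℂ b c‖ ≤ ‖Finsupp.linearCombination ℂ a c‖ := by
  have h1 := h.2 c
  simp only [Matrix.of_apply, mul_sub, sub_mul, Finsupp.sum_sub] at h1
  rw [sum_gram, sum_gram, ← Complex.ofReal_sub] at h1
  have h2 : (0 : ℝ) ≤ ‖Finsupp.linearCombination ℂ a c‖ ^ 2 -
      ‖Finsupp.linearCombination ℂ b c‖ ^ 2 := by exact_mod_cast h1
  exact (sq_le_sq₀ (norm_nonneg _) (norm_nonneg _)).1 (by linarith)

variable [CompleteSpace F]

theorem exists_contraction (a : ι → E) (b : ι → F)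
    (ha : (Submodule.span ℂ (Set.range a)).topologicalClosure = ⊤)
    (h : (Matrix.of fun i j => ⟪a i, a j⟫_ℂ - ⟪b i, b j⟫_ℂ).PosSemidef) :
    ∃ T : E →L[ℂ] F, ‖T‖ ≤ 1 ∧ ∀ i, T (a i) = b i := by
  have hd : DenseRange (Finsupp.linearCombination ℂ a) := by
    have h1 := Submodule.dense_iff_topologicalClosure_eq_top.2 ha
    rw [← Finsupp.range_linearCombination] at h1
    exact h1
  have hn : ∀ c : ι →₀ ℂ,
      ‖Finsupp.linearCombination ℂ b c‖ ≤ 1 * ‖Finsupp.linearCombination ℂ a c‖ := fun c => by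
    rw [one_mul]; exact norm_le_of_posSemidef a b h c
  refine ⟨(Finsupp.linearCombination ℂ b).extendOfNorm (Finsupp.linearCombination ℂ a),
    LinearMap.opNorm_extendOfNorm_le hd zero_le_one hn, fun i => ?_⟩
  have := LinearMap.extendOfNorm_eq hd ⟨1, hn⟩ (Finsupp.single i 1)
  simpa using this

theorem exists_unitary [CompleteSpace E] (a : ι → E) (b : ι → F)
    (ha : (Submodule.span ℂ (Set.range a)).topologicalClosure = ⊤)
    (hb : (Submodule.span ℂ (Set.range b)).topologicalClosure = ⊤)
    (h : ∀ i j, ⟪a i, a j⟫_ℂ = ⟪b i, b j⟫_ℂ) :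
    ∃ U : E ≃ₗᵢ[ℂ] F, ∀ i, U (a i) = b i := by
  obtain ⟨S, hS, hSa⟩ := exists_contraction a b ha (by
    convert Matrix.PosSemidef.zero using 1; ext i j; simp [h])
  obtain ⟨T, hT, hTb⟩ := exists_contraction b a hb (by
    convert Matrix.PosSemidef.zero using 1; ext i j; simp [h])
  have h1 : T ∘L S = ContinuousLinearMap.id ℂ E := by
    refine ContinuousLinearMap.ext_on (Submodule.dense_iff_topologicalClosure_eq_top.2 ha) ?_
    rintro _ ⟨i, rfl⟩
    simp [hSa, hTb]
  have h2 : S ∘L T = ContinuousLinearMap.id ℂ F := by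
    refine ContinuousLinearMap.ext_on (Submodule.dense_iff_topologicalClosure_eq_top.2 hb) ?_
    rintro _ ⟨i, rfl⟩
    simp [hSa, hTb]
  have h1' : ∀ x, T (S x) = x := fun x => by simpa using DFunLike.congr_fun h1 x
  have h2' : ∀ x, S (T x) = x := fun x => by simpa using DFunLike.congr_fun h2 x
  refine ⟨⟨LinearEquiv.ofLinearMap S.toLinearMap T.toLinearMap (LinearMap.ext h2')
    (LinearMap.ext h1'), fun x => ?_⟩, hSa⟩
  change ‖S x‖ = ‖x‖
  refine le_antisymm ((S.le_of_opNorm_le hS x).trans_eq (one_mul _)) ?_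
  calc ‖x‖ = ‖T (S x)‖ := by rw [h1']
    _ ≤ ‖S x‖ := (T.le_of_opNorm_le hT _).trans_eq (one_mul _)

end Gram

/-! ### Reproducing kernel spaces and multipliers -/

/-- A positive definite kernel on `Λ`: `∑ i, j, conj (c i) * K (λ i) (λ j) * c j ≥ 0` for all
finitely supported families `c`. -/
structure PosKernel (Λ : Type u) where
  toFun : Λ → Λ → ℂ
  posSemidef : (Matrix.of toFun).PosSemidef

namespace PosKernel

variable {Λ : Type u}

instance : CoeFun (PosKernel Λ) (fun _ => Λ → Λ → ℂ) := ⟨toFun⟩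

/-- The kernel `K`, with its values regarded as operators on `ℂ`. -/
def opMatrix (K : PosKernel Λ) : Matrix Λ Λ (ℂ →L[ℂ] ℂ) :=
  Matrix.of fun μ l => K μ l • ContinuousLinearMap.id ℂ ℂ

theorem conj_apply (K : PosKernel Λ) (μ l : Λ) : conj (K l μ) = K μ l :=
  K.posSemidef.isHermitian.apply μ l

theorem posSemidef_opMatrix (K : PosKernel Λ) : K.opMatrix.PosSemidef := by
  have h0 := (RKHS.posSemidef_tfae (K := K.opMatrix)).out 0 2
  refine h0.2 ⟨?_, fun c => ?_⟩
  · ext μ l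
    have h1 : star (ContinuousLinearMap.id ℂ ℂ) = ContinuousLinearMap.id ℂ ℂ :=
      star_one (ℂ →L[ℂ] ℂ)
    simp [opMatrix, K.conj_apply, h1]
  · have h := (Complex.le_def.1 (K.posSemidef.2 c)).1
    rw [Finsupp.sum_comm, Complex.zero_re] at h
    convert h using 1
    simp only [Finsupp.sum, map_sum, Complex.re_sum, RCLike.re_to_complex]
    refine Finset.sum_congr rfl fun i _ => Finset.sum_congr rfl fun j _ => ?_
    simp [opMatrix]
    ring

instance (K : PosKernel Λ) : Fact K.opMatrix.PosSemidef := ⟨K.posSemidef_opMatrix⟩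

/-- The reproducing kernel Hilbert space with kernel `K`. -/
def space (K : PosKernel Λ) : Type u := RKHS.OfKernel K.opMatrix

instance (K : PosKernel Λ) : NormedAddCommGroup K.space :=
  inferInstanceAs (NormedAddCommGroup (RKHS.OfKernel K.opMatrix))

instance (K : PosKernel Λ) : InnerProductSpace ℂ K.space :=
  inferInstanceAs (InnerProductSpace ℂ (RKHS.OfKernel K.opMatrix))

instance (K : PosKernel Λ) : CompleteSpace K.space :=
  inferInstanceAs (CompleteSpace (RKHS.OfKernel K.opMatrix))

instance (K : PosKernel Λ) : RKHS ℂ K.space Λ ℂ :=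
  inferInstanceAs (RKHS ℂ (RKHS.OfKernel K.opMatrix) Λ ℂ)

/-- The reproducing kernel function `k_l`. -/
def k (K : PosKernel Λ) (l : Λ) : K.space := RKHS.kerFun K.space l 1

theorem inner_k (K : PosKernel Λ) (l : Λ) (f : K.space) : ⟪K.k l, f⟫_ℂ = f l := by
  simp [k]

theorem k_apply (K : PosKernel Λ) (l μ : Λ) : K.k l μ = K μ l := by
  have h : RKHS.kernel K.space = K.opMatrix := RKHS.OfKernel.kernel_ofKernel
  simp [k, RKHS.kerFun_apply, h, opMatrix]

theorem inner_k_k (K : PosKernel Λ) (μ l : Λ) : ⟪K.k μ, K.k l⟫_ℂ = K μ l := by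
  rw [inner_k, k_apply]

theorem dense_k (K : PosKernel Λ) :
    (Submodule.span ℂ (Set.range K.k)).topologicalClosure = ⊤ := by
  rw [eq_top_iff, ← RKHS.kerFun_dense K.space]
  refine Submodule.topologicalClosure_mono (Submodule.span_le.2 ?_)
  rintro _ ⟨x, v, rfl⟩
  have : RKHS.kerFun K.space x v = v • K.k x := by
    rw [k, ← map_smul]; simp
  rw [SetLike.mem_coe, this]
  exact Submodule.smul_mem _ _ (Submodule.subset_span ⟨x, rfl⟩)

section Multiplier

variable {𝓖 𝓖' : Type*} [NormedAddCommGroup 𝓖] [InnerProductSpace ℂ 𝓖] [CompleteSpace 𝓖]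
  [NormedAddCommGroup 𝓖'] [InnerProductSpace ℂ 𝓖'] [CompleteSpace 𝓖']

/-- `G` is a contractive multiplier: `k_l ⊗ y ↦ k_l ⊗ G(l)* y` extends to a contraction. -/
def IsContractiveMultiplier (K : PosKernel Λ) (G : Λ → 𝓖' →L[ℂ] 𝓖) : Prop :=
  ∃ T : K.space ⊗ₕ 𝓖 →L[ℂ] K.space ⊗ₕ 𝓖', ‖T‖ ≤ 1 ∧
    ∀ l y, T (HTensor.tmul (K.k l) y) = HTensor.tmul (K.k l) ((G l).adjoint y)

/-- The multiplication operator `𝔪_G`, whose adjoint is the (unique) contractive extension of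
`k_l ⊗ y ↦ k_l ⊗ G(l)* y`. -/
def mulOp {K : PosKernel Λ} {G : Λ → 𝓖' →L[ℂ] 𝓖} (hG : K.IsContractiveMultiplier G) :
    K.space ⊗ₕ 𝓖' →L[ℂ] K.space ⊗ₕ 𝓖 :=
  hG.choose.adjoint

theorem norm_mulOp_le {K : PosKernel Λ} {G : Λ → 𝓖' →L[ℂ] 𝓖}
    (hG : K.IsContractiveMultiplier G) : ‖mulOp hG‖ ≤ 1 := by
  rw [mulOp, LinearIsometryEquiv.norm_map]
  exact hG.choose_spec.1

theorem adjoint_mulOp_tmul {K : PosKernel Λ} {G : Λ → 𝓖' →L[ℂ] 𝓖}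
    (hG : K.IsContractiveMultiplier G) (l : Λ) (y : 𝓖) :
    (mulOp hG).adjoint (HTensor.tmul (K.k l) y) =
      HTensor.tmul (K.k l) ((G l).adjoint y) := by
  rw [mulOp, ContinuousLinearMap.adjoint_adjoint]
  exact hG.choose_spec.2 l y

end Multiplier

/-- The contractively included subspace `𝓜_G`, the range space of `𝔪_G`. -/
def multiplierRange {𝓖 𝓖' : Type u} [NormedAddCommGroup 𝓖] [InnerProductSpace ℂ 𝓖]
    [CompleteSpace 𝓖] [NormedAddCommGroup 𝓖'] [InnerProductSpace ℂ 𝓖'] [CompleteSpace 𝓖']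
    {K : PosKernel Λ} {G : Λ → 𝓖' →L[ℂ] 𝓖} (hG : K.IsContractiveMultiplier G) :
    ContractiveSubspace (K.space ⊗ₕ 𝓖) :=
  ContractiveSubspace.range (mulOp hG) (norm_mulOp_le hG)

/-! ### Pick kernels -/

/-- Pick kernels. -/
structure IsPick (K : PosKernel Λ) : Prop where
  ne_zero : ∀ μ l, K μ l ≠ 0
  posSemidef : ∀ l₀, (Matrix.of fun μ l =>
    1 - K μ l₀ * K l₀ l / (K μ l * K l₀ l₀)).PosSemidef

/-- The normalized kernel function `δ` at the base point `l₀`. -/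
def delta (K : PosKernel Λ) (l₀ : Λ) : K.space := ((‖K.k l₀‖⁻¹ : ℝ) : ℂ) • K.k l₀

theorem IsPick.k_ne_zero {K : PosKernel Λ} (hK : K.IsPick) (l₀ : Λ) : K.k l₀ ≠ 0 := by
  intro h
  have h1 := hK.ne_zero l₀ l₀
  rw [← inner_k_k, h, inner_zero_left] at h1
  exact h1 rfl

theorem IsPick.delta_ne_zero {K : PosKernel Λ} (hK : K.IsPick) (l₀ l : Λ) :
    K.delta l₀ l ≠ 0 := by
  have h : ‖K.k l₀‖ ≠ 0 := norm_ne_zero_iff.2 (hK.k_ne_zero l₀)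
  simp [delta, k_apply, h, hK.ne_zero]

/-- The normalized kernel `K'(μ, l) = K(μ, l) / (δ(μ) * conj δ(l))`. -/
def normalize (K : PosKernel Λ) (l₀ : Λ) : PosKernel Λ where
  toFun μ l := K μ l / (K.delta l₀ μ * conj (K.delta l₀ l))
  posSemidef := by
    convert posSemidef_of_gram (fun l => (conj (K.delta l₀ l))⁻¹ • K.k l) using 2
    ext μ l
    rw [inner_smul_left, inner_smul_right, inner_k_k]
    simp only [map_inv₀, Complex.conj_conj, div_eq_mul_inv, mul_inv]
    ring

theorem normalize_apply (K : PosKernel Λ) (l₀ μ l : Λ) :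
    K.normalize l₀ μ l = K μ l / (K.delta l₀ μ * conj (K.delta l₀ l)) := rfl

theorem exists_omega {K : PosKernel Λ} (hK : K.IsPick) (l₀ : Λ) :
    ∃ Ω : K.space ≃ₗᵢ[ℂ] (K.normalize l₀).space, ∀ f l, Ω f l = f l / K.delta l₀ l := by
  have hδ := hK.delta_ne_zero l₀
  have hδ' : ∀ l, conj (K.delta l₀ l) ≠ 0 := fun l => by simpa using hδ l
  have hd : (Submodule.span ℂ (Set.range fun l =>
      conj (K.delta l₀ l) • (K.normalize l₀).k l)).topologicalClosure = ⊤ := by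
    rw [eq_top_iff, ← (K.normalize l₀).dense_k]
    refine Submodule.topologicalClosure_mono (Submodule.span_le.2 ?_)
    rintro _ ⟨l, rfl⟩
    have h1 : (K.normalize l₀).k l = (conj (K.delta l₀ l))⁻¹ •
        (conj (K.delta l₀ l) • (K.normalize l₀).k l) := by
      rw [smul_smul, inv_mul_cancel₀ (hδ' l), one_smul]
    rw [SetLike.mem_coe, h1]
    exact Submodule.smul_mem _ _ (Submodule.subset_span ⟨l, rfl⟩)
  obtain ⟨U, hU⟩ := exists_unitary K.k
    (fun l => conj (K.delta l₀ l) • (K.normalize l₀).k l) K.dense_k hd (fun μ l => by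
      rw [inner_smul_left, inner_smul_right, inner_k_k, inner_k_k, normalize_apply,
        Complex.conj_conj]
      have := hδ μ
      have := hδ' l
      field_simp)
  refine ⟨U, fun f l => ?_⟩
  have h2 := U.inner_map_map (K.k l) f
  rw [hU, inner_smul_left, inner_k, inner_k, Complex.conj_conj] at h2
  rw [← h2, mul_div_cancel_left₀ _ (hδ l)]

/-- The unitary `Ω f = f / δ` from `H(K)` onto `H(K')`. -/
def omega {K : PosKernel Λ} (hK : K.IsPick) (l₀ : Λ) :
    K.space ≃ₗᵢ[ℂ] (K.normalize l₀).space :=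
  (exists_omega hK l₀).choose

theorem omega_apply {K : PosKernel Λ} (hK : K.IsPick) (l₀ : Λ) (f : K.space) (l : Λ) :
    omega hK l₀ f l = f l / K.delta l₀ l :=
  (exists_omega hK l₀).choose_spec f l

/-- The constant functions belonging to `H(K)`. -/
def constants (K : PosKernel Λ) : Submodule ℂ K.space where
  carrier := {f | ∃ c : ℂ, ∀ l, f l = c}
  zero_mem' := ⟨0, fun l => by simp⟩
  add_mem' := by
    rintro f g ⟨c, hc⟩ ⟨d, hd⟩
    exact ⟨c + d, fun l => by simp [hc, hd]⟩
  smul_mem' := by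
    rintro a f ⟨c, hc⟩
    exact ⟨a * c, fun l => by simp [hc]⟩

theorem isClosed_constants (K : PosKernel Λ) : IsClosed (K.constants : Set K.space) := by
  have h : (K.constants : Set K.space) = ⋂ (l : Λ) (μ : Λ), {f : K.space | f l = f μ} := by
    ext f
    simp only [SetLike.mem_coe, Set.mem_iInter, Set.mem_ofPred_eq]
    constructor
    · rintro ⟨c, hc⟩ l μ
      rw [hc, hc]
    · intro h
      rcases isEmpty_or_nonempty Λ with hΛ | ⟨⟨l⟩⟩
      · exact ⟨0, fun l => (hΛ.false l).elim⟩
      · exact ⟨f l, fun μ => h μ l⟩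
  rw [h]
  exact isClosed_iInter fun l => isClosed_iInter fun μ =>
    isClosed_eq (RKHS.continuous_eval l) (RKHS.continuous_eval μ)

instance (K : PosKernel Λ) : CompleteSpace K.constants :=
  K.isClosed_constants.completeSpace_coe

/-- The orthogonal projection of `H(K)` onto the constant functions. -/
def constProj (K : PosKernel Λ) : K.space →L[ℂ] K.space := K.constants.starProjection

section Shift

variable {𝓑 : Type*} [NormedAddCommGroup 𝓑] [InnerProductSpace ℂ 𝓑]

/-- `β : Λ → 𝓑` is the function associated with the Pick kernel `K` and the base point `l₀`:
`K(μ, l) = δ(μ) * conj δ(l) / (1 - ⟨β(l), β(μ)⟩)`, and the values of `β` span a dense subspace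
of `𝓑`. (The scalar product of Mathlib is linear in the second variable.) -/
structure IsPickFunction (K : PosKernel Λ) (l₀ : Λ) (β : Λ → 𝓑) : Prop where
  eq_div : ∀ μ l, K μ l = K.delta l₀ μ * conj (K.delta l₀ l) / (1 - ⟪β μ, β l⟫_ℂ)
  dense_span : (Submodule.span ℂ (Set.range β)).topologicalClosure = ⊤

/-- Every Pick kernel has an associated function `β`. -/
theorem IsPick.exists_isPickFunction {K : PosKernel Λ} (hK : K.IsPick) (l₀ : Λ) :
    ∃ L : PosKernel Λ, K.IsPickFunction l₀ L.k := by
  refine ⟨⟨_, hK.posSemidef l₀⟩, ⟨fun μ l => ?_, dense_k _⟩⟩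
  have h0 : ‖K.k l₀‖ ≠ 0 := norm_ne_zero_iff.2 (hK.k_ne_zero l₀)
  have h1 : K l₀ l₀ = (‖K.k l₀‖ : ℂ) ^ 2 := by
    rw [← inner_k_k]; exact inner_self_eq_norm_sq_to_K _
  have h2 := hK.ne_zero μ l
  have h3 := hK.ne_zero μ l₀
  have h4 := hK.ne_zero l₀ l
  have h5 : (‖K.k l₀‖ : ℂ) ≠ 0 := by exact_mod_cast h0
  rw [inner_k_k]
  simp only [delta, RKHS.coe_smul, Pi.smul_apply, k_apply, smul_eq_mul, map_mul,
    Complex.conj_ofReal, conj_apply, h1]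
  push_cast
  field_simp
  ring_nf

theorem IsPickFunction.one_sub_mul_normalize {K : PosKernel Λ} (hK : K.IsPick) {l₀ : Λ}
    {β : Λ → 𝓑} (hβ : K.IsPickFunction l₀ β) (μ l : Λ) :
    (1 - ⟪β μ, β l⟫_ℂ) * K.normalize l₀ μ l = 1 := by
  have h1 : 1 - ⟪β μ, β l⟫_ℂ ≠ 0 := fun h => hK.ne_zero μ l (by rw [hβ.eq_div, h, div_zero])
  have h2 := hK.delta_ne_zero l₀ μ
  have h3 : conj (K.delta l₀ l) ≠ 0 := by simpa using hK.delta_ne_zero l₀ l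
  rw [normalize_apply, hβ.eq_div]
  field_simp

theorem exists_adjoint_shift {K : PosKernel Λ} (hK : K.IsPick) {l₀ : Λ}
    {β : Λ → 𝓑} (hβ : K.IsPickFunction l₀ β) :
    ∃ T : (K.normalize l₀).space →L[ℂ] 𝓑 ⊗ₕ (K.normalize l₀).space, ‖T‖ ≤ 1 ∧
      ∀ l, T ((K.normalize l₀).k l) = HTensor.tmul (β l) ((K.normalize l₀).k l) := by
  refine exists_contraction _ _ (K.normalize l₀).dense_k ?_
  convert posSemidef_of_gram (fun _ : Λ => (1 : ℂ)) using 2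
  ext μ l
  rw [HTensor.inner_tmul, inner_k_k]
  have := hβ.one_sub_mul_normalize hK μ l
  simp only [RCLike.inner_apply, map_one, mul_one]
  rw [← this]
  ring

/-- The operator `𝐁 : 𝓑 ⊗ H(K') → H(K')` of multiplication by `B(l) ξ = ⟨ξ, β(l)⟩`. As
`B(l)* 1 = β(l)`, its adjoint is the (unique) contractive extension of `k'_l ↦ β(l) ⊗ k'_l`. -/
def shift {K : PosKernel Λ} (hK : K.IsPick) {l₀ : Λ} {β : Λ → 𝓑}
    (hβ : K.IsPickFunction l₀ β) :
    𝓑 ⊗ₕ (K.normalize l₀).space →L[ℂ] (K.normalize l₀).space :=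
  (exists_adjoint_shift hK hβ).choose.adjoint

theorem norm_shift_le {K : PosKernel Λ} (hK : K.IsPick) {l₀ : Λ} {β : Λ → 𝓑}
    (hβ : K.IsPickFunction l₀ β) : ‖shift hK hβ‖ ≤ 1 := by
  rw [shift, LinearIsometryEquiv.norm_map]
  exact (exists_adjoint_shift hK hβ).choose_spec.1

theorem shift_tmul_apply {K : PosKernel Λ} (hK : K.IsPick) {l₀ : Λ} {β : Λ → 𝓑}
    (hβ : K.IsPickFunction l₀ β) (ξ : 𝓑) (f : (K.normalize l₀).space) (l : Λ) :
    shift hK hβ (HTensor.tmul ξ f) l = ⟪β l, ξ⟫_ℂ * f l := by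
  rw [← inner_k, shift, ContinuousLinearMap.adjoint_inner_right,
    (exists_adjoint_shift hK hβ).choose_spec.2, HTensor.inner_tmul, inner_k]

/-- The operator `𝐁 ⊗ I : 𝓑 ⊗ H(K') ⊗ 𝓖 → H(K') ⊗ 𝓖`. -/
def shiftTensor {K : PosKernel Λ} (hK : K.IsPick) {l₀ : Λ} {β : Λ → 𝓑}
    (hβ : K.IsPickFunction l₀ β) (𝓖 : Type*) [NormedAddCommGroup 𝓖] [InnerProductSpace ℂ 𝓖] :
    𝓑 ⊗ₕ ((K.normalize l₀).space ⊗ₕ 𝓖) →L[ℂ] (K.normalize l₀).space ⊗ₕ 𝓖 :=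
  HTensor.map (shift hK hβ) (ContinuousLinearMap.id ℂ 𝓖) ∘L
    (HTensor.assoc 𝓑 (K.normalize l₀).space 𝓖).toContinuousLinearEquiv.toContinuousLinearMap

end Shift

end PosKernel

end

/-! ### Operators and vectors determined on total families -/

section Total

variable {ι κ E F : Type*} [NormedAddCommGroup E] [InnerProductSpace ℂ E]
  [NormedAddCommGroup F] [InnerProductSpace ℂ F]

/-! Both conditions are turned into operator relations for `D`, the inclusion of ΩN into H(K') ⊗ 𝓖.
Write R for 𝐁 ⊗ I and Q for π' ⊗ I. Complementarity of two contractively included spaces with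
inclusions A and B means AA* + BB* = I (`ContractiveSubspace.isComplement_iff`). Hence, after
transport by Ω, (i) says that T*T + DD* = I for some T with k'_l ⊗ y ↦ k'_l ⊗ G(l)*y
(`PosKernel.exists_isComplement_iff`).

By Douglas factorisation, (ii) is equivalent to DD* ≤ Q + R(I ⊗ DD*)R*
(`PosKernel.exists_lift_iff`). The link is the kernel identity (1 - ⟨β(l), β(μ)⟩)K'(μ, l) = 1, which
in operator form is RR* + Q = I (`PosKernel.shiftTensor_comp_adjoint_add`).

If T comes from a multiplier, it intertwines the operators R*, and substituting DD* = I - T*T gives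
the inequality with defect T*QT (`PosKernel.norm_sq_adjoint_le_of_multiplier`). Conversely, factor
the defect Q + R(I ⊗ DD*)R* - DD* as Z*Z. Its matrix entries on the vectors k'_l ⊗ y, multiplied by
K'(μ, l), are those of I - DD*, so G(l)*y = Z(k'_l ⊗ y) defines the multiplier
(`PosKernel.exists_multiplier_of_norm_sq_adjoint_le`). -/

theorem ContinuousLinearMap.ext_of_total {a : ι → E}
    (ha : (Submodule.span ℂ (Set.range a)).topologicalClosure = ⊤) {A B : E →L[ℂ] F}
    (h : ∀ i, A (a i) = B (a i)) : A = B := by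
  refine ContinuousLinearMap.ext_on (Submodule.dense_iff_topologicalClosure_eq_top.2 ha) ?_
  rintro _ ⟨i, rfl⟩
  exact h i

theorem eq_of_inner_total {a : ι → E}
    (ha : (Submodule.span ℂ (Set.range a)).topologicalClosure = ⊤) {x y : E}
    (h : ∀ i, ⟪a i, x⟫_ℂ = ⟪a i, y⟫_ℂ) : x = y := by
  have h1 : innerSL ℂ x = innerSL ℂ y := ContinuousLinearMap.ext_of_total ha fun i => by
    simp only [innerSL_apply_apply]
    rw [← inner_conj_symm, h, inner_conj_symm]
  exact ext_inner_right ℂ fun z => by simpa using DFunLike.congr_fun h1 z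

theorem ContinuousLinearMap.ext_of_inner_total {a : ι → E} {b : κ → F}
    (ha : (Submodule.span ℂ (Set.range a)).topologicalClosure = ⊤)
    (hb : (Submodule.span ℂ (Set.range b)).topologicalClosure = ⊤) {A B : E →L[ℂ] F}
    (h : ∀ i j, ⟪b j, A (a i)⟫_ℂ = ⟪b j, B (a i)⟫_ℂ) : A = B :=
  ContinuousLinearMap.ext_of_total ha fun i => eq_of_inner_total hb (h i)

theorem total_id : (Submodule.span ℂ (Set.range (id : E → E))).topologicalClosure = ⊤ := by
  rw [Set.range_id, Submodule.span_univ]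
  exact top_unique (Submodule.le_topologicalClosure _)

end Total

/-! ### Calculus of Hilbert space tensor products -/

namespace HTensor

variable {E F E' F' E'' F'' : Type*} [NormedAddCommGroup E] [InnerProductSpace ℂ E]
  [NormedAddCommGroup F] [InnerProductSpace ℂ F] [NormedAddCommGroup E'] [InnerProductSpace ℂ E']
  [NormedAddCommGroup F'] [InnerProductSpace ℂ F'] [NormedAddCommGroup E'']
  [InnerProductSpace ℂ E''] [NormedAddCommGroup F''] [InnerProductSpace ℂ F'']

theorem add_tmul (x x' : E) (y : F) : tmul (x + x') y = tmul x y + tmul x' y := by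
  simp [tmul, TensorProduct.add_tmul]

theorem tmul_add (x : E) (y y' : F) : tmul x (y + y') = tmul x y + tmul x y' := by
  simp [tmul, TensorProduct.tmul_add]

theorem smul_tmul (c : ℂ) (x : E) (y : F) : tmul (c • x) y = c • tmul x y := by
  rw [tmul, ← TensorProduct.smul_tmul', map_smul, tmul]

theorem tmul_smul (c : ℂ) (x : E) (y : F) : tmul x (c • y) = c • tmul x y := by
  simp [tmul]

theorem continuous_tmul : Continuous fun p : E × F => tmul p.1 p.2 :=
  (incl E F).continuous.comp TensorProduct.continuous_tmul

/-- The closed span absorbs limits in one factor at a time, because the tensor product of vectors is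
continuous in each of them. It thus contains all simple tensors, whose span is dense. -/
theorem total_tmul {ι κ : Type*} {a : ι → E} {b : κ → F}
    (ha : (Submodule.span ℂ (Set.range a)).topologicalClosure = ⊤)
    (hb : (Submodule.span ℂ (Set.range b)).topologicalClosure = ⊤) :
    (Submodule.span ℂ (Set.range fun p : ι × κ =>
      tmul (a p.1) (b p.2))).topologicalClosure = ⊤ := by
  set S := (Submodule.span ℂ (Set.range fun p : ι × κ =>
    tmul (a p.1) (b p.2))).topologicalClosure with hS
  have hc : IsClosed (S : Set (E ⊗ₕ F)) := Submodule.isClosed_topologicalClosure _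
  have h1 : ∀ i y, tmul (a i) y ∈ S := by
    intro i y
    have hy : y ∈ (Submodule.span ℂ (Set.range b)).topologicalClosure := hb ▸ Submodule.mem_top
    refine closure_minimal (s := (Submodule.span ℂ (Set.range b) : Set F))
      (t := {y | tmul (a i) y ∈ S}) (fun z hz => ?_)
      (hc.preimage (continuous_tmul.comp (Continuous.prodMk_right (a i)))) hy
    induction hz using Submodule.span_induction with
    | mem z hz =>
      obtain ⟨j, rfl⟩ := hz
      exact Submodule.le_topologicalClosure _ (Submodule.subset_span ⟨(i, j), rfl⟩)
    | zero => simp [tmul]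
    | add u v _ _ hu hv => simpa [tmul_add] using add_mem hu hv
    | smul c u _ hu => simpa [tmul_smul] using S.smul_mem c hu
  have h2 : ∀ x y, tmul x y ∈ S := by
    intro x y
    have hx : x ∈ (Submodule.span ℂ (Set.range a)).topologicalClosure := ha ▸ Submodule.mem_top
    refine closure_minimal (s := (Submodule.span ℂ (Set.range a) : Set E))
      (t := {x | tmul x y ∈ S}) (fun z hz => ?_)
      (hc.preimage (continuous_tmul.comp (Continuous.prodMk_left y))) hx
    induction hz using Submodule.span_induction with
    | mem z hz =>
      obtain ⟨i, rfl⟩ := hz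
      exact h1 i y
    | zero => simp [tmul]
    | add u v _ _ hu hv => simpa [add_tmul] using add_mem hu hv
    | smul c u _ hu => simpa [smul_tmul] using S.smul_mem c hu
  rw [eq_top_iff]
  intro w _
  refine (denseRange_incl E F).induction_on (p := fun w => w ∈ S) w hc fun z => ?_
  induction z using TensorProduct.induction_on with
  | zero => simp
  | tmul x y => exact h2 x y
  | add u v hu hv => simpa using add_mem hu hv

theorem ext_tmul {A B : E ⊗ₕ F →L[ℂ] E'} (h : ∀ x y, A (tmul x y) = B (tmul x y)) : A = B :=
  ContinuousLinearMap.ext_of_total (total_tmul total_id total_id) fun p => h p.1 p.2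

theorem map_comp (S' : E' →L[ℂ] E'') (T' : F' →L[ℂ] F'') (S : E →L[ℂ] E') (T : F →L[ℂ] F') :
    map S' T' ∘L map S T = map (S' ∘L S) (T' ∘L T) :=
  ext_tmul fun x y => by simp [map_tmul]

theorem map_id : map (ContinuousLinearMap.id ℂ E) (ContinuousLinearMap.id ℂ F) =
    ContinuousLinearMap.id ℂ (E ⊗ₕ F) :=
  ext_tmul fun x y => by simp [map_tmul]

theorem map_add_right (S : E →L[ℂ] E') (T T' : F →L[ℂ] F') :
    map S (T + T') = map S T + map S T' :=
  ext_tmul fun x y => by simp [map_tmul, tmul_add]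

variable [CompleteSpace E] [CompleteSpace F] [CompleteSpace E'] [CompleteSpace F']

theorem adjoint_map (S : E →L[ℂ] E') (T : F →L[ℂ] F') :
    (map S T).adjoint = map S.adjoint T.adjoint :=
  ContinuousLinearMap.ext_of_inner_total (total_tmul total_id total_id)
    (total_tmul total_id total_id) fun p q => by
      simp [ContinuousLinearMap.adjoint_inner_right, map_tmul, inner_tmul]

end HTensor

/-! ### Douglas factorisation and row contractions -/

section Operators

variable {E F H H' : Type*} [NormedAddCommGroup E] [InnerProductSpace ℂ E] [CompleteSpace E]
  [NormedAddCommGroup F] [InnerProductSpace ℂ F] [CompleteSpace F]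
  [NormedAddCommGroup H] [InnerProductSpace ℂ H]
  [NormedAddCommGroup H'] [InnerProductSpace ℂ H'] [CompleteSpace H']

open ContinuousLinearMap

/-- Douglas' factorisation: if `‖B h‖ ≤ ‖A h‖` for all `h`, then `B = W A` with a contraction
`W`. -/
theorem ContinuousLinearMap.exists_contraction_comp_eq (A : H →L[ℂ] E) (B : H →L[ℂ] F)
    (h : ∀ z, ‖B z‖ ≤ ‖A z‖) : ∃ W : E →L[ℂ] F, ‖W‖ ≤ 1 ∧ W ∘L A = B := by
  let R : Submodule ℂ E := (LinearMap.range A.toLinearMap).topologicalClosure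
  have hR : IsClosed (R : Set E) := Submodule.isClosed_topologicalClosure _
  have : CompleteSpace R := hR.completeSpace_coe
  let A' : H →L[ℂ] R := A.codRestrict R fun z => Submodule.le_topologicalClosure _ ⟨z, rfl⟩
  have hd : DenseRange A'.toLinearMap := by
    rintro ⟨x, hx⟩
    rw [Topology.IsInducing.subtypeVal.closure_eq_preimage_closure_image, Set.mem_preimage,
      ← Set.range_comp]
    exact hx
  have hn : ∀ z, ‖B.toLinearMap z‖ ≤ 1 * ‖A'.toLinearMap z‖ := fun z => by
    rw [one_mul]; exact h z
  have hW := LinearMap.opNorm_extendOfNorm_le hd zero_le_one hn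
  -- `W` sends A z to B z on the closure of the range of A and vanishes on its orthogonal
  -- complement.
  refine ⟨B.toLinearMap.extendOfNorm A'.toLinearMap ∘L R.orthogonalProjectionOnto, ?_, ?_⟩
  · refine opNorm_le_bound _ zero_le_one fun x => ?_
    rw [comp_apply, one_mul]
    refine (le_of_opNorm_le _ hW _).trans ?_
    rw [one_mul]
    exact (le_of_opNorm_le _ R.orthogonalProjectionOnto_norm_le x).trans_eq (one_mul _)
  · ext z
    have h1 : R.orthogonalProjectionOnto (A z) = A' z :=
      R.orthogonalProjectionOnto_mem_subspace_eq_self (A' z)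
    rw [comp_apply, comp_apply, h1]
    exact LinearMap.extendOfNorm_eq hd ⟨1, hn⟩ z

variable [CompleteSpace H]

theorem ContinuousLinearMap.inner_comp_adjoint_self (A : E →L[ℂ] H) (z w : H) :
    ⟪z, (A ∘L A.adjoint) w⟫_ℂ = ⟪A.adjoint z, A.adjoint w⟫_ℂ := by
  rw [comp_apply, adjoint_inner_left]

theorem ContinuousLinearMap.inner_adjoint_comp_self (A : E →L[ℂ] H) (z w : E) :
    ⟪z, (A.adjoint ∘L A) w⟫_ℂ = ⟪A z, A w⟫_ℂ := by
  rw [comp_apply, adjoint_inner_right]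

theorem norm_sq_eq_of_comp_adjoint_add {A : E →L[ℂ] H} {B : F →L[ℂ] H}
    (h : A ∘L A.adjoint + B ∘L B.adjoint = ContinuousLinearMap.id ℂ H) (z : H) :
    ‖z‖ ^ 2 = ‖A.adjoint z‖ ^ 2 + ‖B.adjoint z‖ ^ 2 := by
  have h1 : ⟪z, z⟫_ℂ = ⟪A.adjoint z, A.adjoint z⟫_ℂ + ⟪B.adjoint z, B.adjoint z⟫_ℂ := by
    rw [← inner_comp_adjoint_self, ← inner_comp_adjoint_self, ← inner_add_right, ← add_apply, h,
      id_apply]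
  simp only [inner_self_eq_norm_sq_to_K] at h1
  exact_mod_cast h1

theorem ContinuousLinearMap.exists_adjoint_comp_self_eq {Y : H →L[ℂ] H} (hY : Y.IsPositive) :
    ∃ Z : H →L[ℂ] H, Z.adjoint ∘L Z = Y := by
  refine ⟨CFC.sqrt Y, ?_⟩
  have h : star (CFC.sqrt Y) = CFC.sqrt Y := (CFC.sqrt_nonneg Y).isSelfAdjoint
  rw [star_eq_adjoint] at h
  rw [h]
  exact CFC.sqrt_mul_sqrt_self Y ((nonneg_iff_isPositive Y).2 hY)

/-- Douglas' factorisation through a column of two operators. -/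
theorem ContinuousLinearMap.exists_column_factorization (D : F →L[ℂ] H) (P : E →L[ℂ] H)
    (R : H' →L[ℂ] H)
    (h : ∀ z, ‖D.adjoint z‖ ^ 2 ≤ ‖P.adjoint z‖ ^ 2 + ‖R.adjoint z‖ ^ 2) :
    ∃ (W₁ : F →L[ℂ] E) (W₂ : F →L[ℂ] H'),
      (∀ x, ‖W₁ x‖ ^ 2 + ‖W₂ x‖ ^ 2 ≤ ‖x‖ ^ 2) ∧ ∀ x, D x = P (W₁ x) + R (W₂ x) := by
  -- With the ℓ² norm on the product, the hypothesis reads ‖D*z‖ ≤ ‖Az‖. Then D* = WA, and the two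
  -- components of W* are the required operators.
  let A : H →L[ℂ] WithLp 2 (E × H') :=
    (WithLp.prodContinuousLinearEquiv 2 ℂ E H').symm.toContinuousLinearMap ∘L
      (P.adjoint.prod R.adjoint)
  have hA : ∀ z, ‖A z‖ ^ 2 = ‖P.adjoint z‖ ^ 2 + ‖R.adjoint z‖ ^ 2 := fun z => by
    rw [WithLp.prod_norm_sq_eq_of_L2]; rfl
  obtain ⟨W, hW, hWA⟩ := exists_contraction_comp_eq A D.adjoint fun z =>
    (sq_le_sq₀ (norm_nonneg _) (norm_nonneg _)).1 ((h z).trans_eq (hA z).symm)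
  refine ⟨WithLp.fstL 2 ℂ E H' ∘L W.adjoint, WithLp.sndL 2 ℂ E H' ∘L W.adjoint,
    fun x => ?_, fun x => ?_⟩
  · have h1 : ‖W.adjoint x‖ ≤ ‖x‖ := by
      refine (le_of_opNorm_le _ (c := 1) ?_ x).trans_eq (one_mul _)
      rwa [LinearIsometryEquiv.norm_map]
    have h2 := (sq_le_sq₀ (norm_nonneg _) (norm_nonneg _)).2 h1
    rwa [WithLp.prod_norm_sq_eq_of_L2] at h2
  · refine ext_inner_left ℂ fun z => ?_
    rw [← adjoint_inner_left, ← hWA, comp_apply, ← adjoint_inner_right,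
      WithLp.prod_inner_apply, inner_add_right]
    simp only [A, comp_apply, ← adjoint_inner_left P, ← adjoint_inner_left R]
    rfl

/-- The adjoint of a contraction is a contraction. Testing on the pair (A*z, B*z), with image v,
gives ‖v‖² ≤ s and s = ⟨z, v⟩ ≤ ‖z‖‖v‖, whence 2s ≤ ‖z‖² + ‖v‖² ≤ ‖z‖² + s. -/
theorem ContinuousLinearMap.norm_sq_add_le_of_row_contraction (A : E →L[ℂ] H) (B : F →L[ℂ] H)
    (h : ∀ x y, ‖A x + B y‖ ^ 2 ≤ ‖x‖ ^ 2 + ‖y‖ ^ 2) (z : H) :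
    ‖A.adjoint z‖ ^ 2 + ‖B.adjoint z‖ ^ 2 ≤ ‖z‖ ^ 2 := by
  have h0 := h (A.adjoint z) (B.adjoint z)
  set v := A (A.adjoint z) + B (B.adjoint z) with hv
  set s := ‖A.adjoint z‖ ^ 2 + ‖B.adjoint z‖ ^ 2 with hs
  have h1 : ⟪z, v⟫_ℂ = (s : ℝ) := by
    rw [hv, inner_add_right, ← adjoint_inner_left A, ← adjoint_inner_left B,
      inner_self_eq_norm_sq_to_K, inner_self_eq_norm_sq_to_K, hs]
    push_cast
    rfl
  have h2 : s ≤ ‖z‖ * ‖v‖ := by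
    have := norm_inner_le_norm (𝕜 := ℂ) z v
    rw [h1, Complex.norm_real] at this
    exact (le_abs_self s).trans this
  nlinarith [sq_nonneg (‖z‖ - ‖v‖), norm_nonneg z, norm_nonneg v]

/-- A pair of vectors through which a row contraction attains its norm is given by the
adjoints. -/
theorem ContinuousLinearMap.eq_adjoint_of_row_contraction (A : E →L[ℂ] H) (B : F →L[ℂ] H)
    (h : ∀ x y, ‖A x + B y‖ ^ 2 ≤ ‖x‖ ^ 2 + ‖y‖ ^ 2) (x : E) (y : F)
    (hxy : ‖A x + B y‖ ^ 2 = ‖x‖ ^ 2 + ‖y‖ ^ 2) :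
    x = A.adjoint (A x + B y) ∧ y = B.adjoint (A x + B y) := by
  have h0 := norm_sq_add_le_of_row_contraction A B h (A x + B y)
  set z := A x + B y with hz
  have h1 : RCLike.re ⟪A.adjoint z, x⟫_ℂ + RCLike.re ⟪B.adjoint z, y⟫_ℂ = ‖z‖ ^ 2 := by
    rw [adjoint_inner_left, adjoint_inner_left, ← map_add, ← inner_add_right, ← hz,
      inner_self_eq_norm_sq]
  have h2 := norm_sub_sq (𝕜 := ℂ) (A.adjoint z) x
  have h3 := norm_sub_sq (𝕜 := ℂ) (B.adjoint z) y
  -- The sum ‖A*z - x‖² + ‖B*z - y‖² expands to at most ‖z‖² - 2‖z‖² + ‖z‖² = 0.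
  have h4 : ‖A.adjoint z - x‖ ^ 2 = 0 := by
    nlinarith [sq_nonneg ‖A.adjoint z - x‖, sq_nonneg ‖B.adjoint z - y‖]
  have h5 : ‖B.adjoint z - y‖ ^ 2 = 0 := by
    nlinarith [sq_nonneg ‖A.adjoint z - x‖, sq_nonneg ‖B.adjoint z - y‖]
  exact ⟨(sub_eq_zero.1 (norm_eq_zero.1 (pow_eq_zero_iff two_ne_zero |>.1 h4))).symm,
    (sub_eq_zero.1 (norm_eq_zero.1 (pow_eq_zero_iff two_ne_zero |>.1 h5))).symm⟩

/-- The difference of the two sides is exactly ‖A*z - x‖² + ‖B*z - y‖² for z = Ax + By. -/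
theorem ContinuousLinearMap.norm_add_sq_le_of_comp_adjoint_add {A : E →L[ℂ] H} {B : F →L[ℂ] H}
    (h : A ∘L A.adjoint + B ∘L B.adjoint = ContinuousLinearMap.id ℂ H) (x : E) (y : F) :
    ‖A x + B y‖ ^ 2 ≤ ‖x‖ ^ 2 + ‖y‖ ^ 2 := by
  set z := A x + B y with hz
  have h0 := norm_sq_eq_of_comp_adjoint_add h z
  have h1 : RCLike.re ⟪A.adjoint z, x⟫_ℂ + RCLike.re ⟪B.adjoint z, y⟫_ℂ = ‖z‖ ^ 2 := by
    rw [adjoint_inner_left, adjoint_inner_left, ← map_add, ← inner_add_right, ← hz,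
      inner_self_eq_norm_sq]
  have h2 := norm_sub_sq (𝕜 := ℂ) (A.adjoint z) x
  have h3 := norm_sub_sq (𝕜 := ℂ) (B.adjoint z) y
  nlinarith [sq_nonneg ‖A.adjoint z - x‖, sq_nonneg ‖B.adjoint z - y‖]

end Operators

/-! ### Complementary subspaces as an operator identity -/

namespace ContractiveSubspace

open ContinuousLinearMap

variable {H : Type u} [NormedAddCommGroup H] [InnerProductSpace ℂ H] [CompleteSpace H]

/-- A norm-attaining decomposition of z can only be given by the adjoints of the inclusions applied
to z, so its existence for every z is the operator identity. Conversely, the identity makes the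
column of adjoints isometric, and the adjoints supply the decomposition. -/
theorem isComplement_iff (M N : ContractiveSubspace H) :
    M.IsComplement N ↔
      M.incl ∘L M.incl.adjoint + N.incl ∘L N.incl.adjoint = ContinuousLinearMap.id ℂ H := by
  constructor
  · rintro ⟨h1, h2⟩
    ext z
    obtain ⟨⟨x, y⟩, ⟨hz, hn⟩, -⟩ := h2 z
    obtain ⟨hx, hy⟩ := eq_adjoint_of_row_contraction M.incl N.incl h1 x y (by rw [← hz, hn])
    rw [← hz] at hx hy
    rw [add_apply, comp_apply, comp_apply, ← hx, ← hy, id_apply]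
    exact hz.symm
  · intro h
    have h1 := norm_add_sq_le_of_comp_adjoint_add h
    refine ⟨h1, fun z => ⟨(M.incl.adjoint z, N.incl.adjoint z), ⟨?_, ?_⟩, ?_⟩⟩
    · simpa using (DFunLike.congr_fun h z).symm
    · exact norm_sq_eq_of_comp_adjoint_add h z
    · rintro ⟨x, y⟩ ⟨hz, hn⟩
      obtain ⟨hx, hy⟩ := eq_adjoint_of_row_contraction M.incl N.incl h1 x y (by rw [← hz, hn])
      rw [← hz] at hx hy
      exact Prod.ext hx hy

/-- The range of C* lies in (ker C)ᗮ, so restricting C to that subspace does not change CC*. -/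
theorem range_incl_comp_adjoint {E : Type u} [NormedAddCommGroup E] [InnerProductSpace ℂ E]
    [CompleteSpace E] (C : E →L[ℂ] H) (hC : ‖C‖ ≤ 1) :
    (range C hC).incl ∘L (range C hC).incl.adjoint = C ∘L C.adjoint := by
  have hmem : ∀ z, C.adjoint z ∈ (LinearMap.ker C.toLinearMap)ᗮ := fun z => by
    rw [Submodule.mem_orthogonal]
    intro u hu
    have hu' : C u = 0 := hu
    rw [adjoint_inner_right, hu', inner_zero_left]
  have key : ∀ z, (range C hC).incl.adjoint z = (⟨C.adjoint z, hmem z⟩ :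
      ↥((LinearMap.ker C.toLinearMap)ᗮ)) := fun z => by
    refine ext_inner_right ℂ fun x => ?_
    rw [adjoint_inner_left]
    exact (adjoint_inner_left C _ _).symm
  ext z
  rw [comp_apply, key]
  rfl

end ContractiveSubspace

/-! ### The normalized kernel and the projection onto constants -/

namespace PosKernel

open ContinuousLinearMap

variable {Λ : Type u}

theorem total_k_tmul (K : PosKernel Λ) (𝓖 : Type*) [NormedAddCommGroup 𝓖]
    [InnerProductSpace ℂ 𝓖] :
    (Submodule.span ℂ (Set.range fun p : Λ × 𝓖 =>
      HTensor.tmul (K.k p.1) (id p.2))).topologicalClosure = ⊤ :=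
  HTensor.total_tmul K.dense_k total_id

theorem normalize_base {K : PosKernel Λ} (hK : K.IsPick) (l₀ l : Λ) :
    K.normalize l₀ l l₀ = 1 := by
  have h0 : (‖K.k l₀‖ : ℂ) ≠ 0 := by
    exact_mod_cast norm_ne_zero_iff.2 (hK.k_ne_zero l₀)
  have h1 : K l₀ l₀ = (‖K.k l₀‖ : ℂ) ^ 2 := by
    rw [← inner_k_k]; exact inner_self_eq_norm_sq_to_K _
  have h2 := hK.ne_zero l l₀
  rw [normalize_apply]
  simp only [delta, RKHS.coe_smul, Pi.smul_apply, k_apply, smul_eq_mul, map_mul, map_pow,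
    Complex.conj_ofReal, h1]
  push_cast
  field_simp

/-- Normalization at l₀ makes k'_{l₀} the constant 1. The difference k'_l - k'_{l₀} is orthogonal to
every constant, since evaluation at l and at l₀ agree there. -/
theorem constProj_normalize_k {K : PosKernel Λ} (hK : K.IsPick) (l₀ l : Λ) :
    (K.normalize l₀).constProj ((K.normalize l₀).k l) = (K.normalize l₀).k l₀ := by
  refine Submodule.eq_starProjection_of_mem_of_inner_eq_zero
    (K := (K.normalize l₀).constants) ⟨1, fun μ => ?_⟩ ?_
  · rw [k_apply, normalize_base hK]
  · rintro f ⟨c, hc⟩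
    rw [inner_sub_left, inner_k, inner_k, hc, hc, sub_self]

theorem inner_constTensor {K : PosKernel Λ} (hK : K.IsPick) (l₀ : Λ) {𝓖 : Type*}
    [NormedAddCommGroup 𝓖] [InnerProductSpace ℂ 𝓖] (μ l : Λ) (z y : 𝓖) :
    ⟪HTensor.tmul ((K.normalize l₀).k μ) z,
      HTensor.map (K.normalize l₀).constProj (ContinuousLinearMap.id ℂ 𝓖)
        (HTensor.tmul ((K.normalize l₀).k l) y)⟫_ℂ = ⟪z, y⟫_ℂ := by
  rw [HTensor.map_tmul, HTensor.inner_tmul, constProj_normalize_k hK, inner_k_k,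
    normalize_base hK, one_mul, id_apply]

section Const

variable (K : PosKernel Λ) (𝓖 : Type*) [NormedAddCommGroup 𝓖] [InnerProductSpace ℂ 𝓖]

theorem constTensor_comp_self :
    HTensor.map K.constProj (ContinuousLinearMap.id ℂ 𝓖) ∘L
      HTensor.map K.constProj (ContinuousLinearMap.id ℂ 𝓖) =
    HTensor.map K.constProj (ContinuousLinearMap.id ℂ 𝓖) := by
  rw [HTensor.map_comp]
  congr 1
  exact K.constants.isIdempotentElem_starProjection

theorem adjoint_constTensor [CompleteSpace 𝓖] :
    (HTensor.map K.constProj (ContinuousLinearMap.id ℂ 𝓖)).adjoint =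
      HTensor.map K.constProj (ContinuousLinearMap.id ℂ 𝓖) := by
  rw [HTensor.adjoint_map, adjoint_id]
  congr 1
  exact isSelfAdjoint_starProjection K.constants

end Const

/-! ### The operator 𝐁 ⊗ I and the lifting condition -/

section Shift

variable {𝓑 : Type*} [NormedAddCommGroup 𝓑] [InnerProductSpace ℂ 𝓑]
  {K : PosKernel Λ} (hK : K.IsPick) {l₀ : Λ} {β : Λ → 𝓑} (hβ : K.IsPickFunction l₀ β)
  {𝓖 : Type*} [NormedAddCommGroup 𝓖] [InnerProductSpace ℂ 𝓖]

theorem adjoint_shift_k (l : Λ) :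
    (shift hK hβ).adjoint ((K.normalize l₀).k l) =
      HTensor.tmul (β l) ((K.normalize l₀).k l) := by
  rw [shift, adjoint_adjoint]
  exact (exists_adjoint_shift hK hβ).choose_spec.2 l

theorem adjoint_shiftTensor_tmul (l : Λ) (y : 𝓖) :
    (shiftTensor hK hβ 𝓖).adjoint (HTensor.tmul ((K.normalize l₀).k l) y) =
      HTensor.tmul (β l) (HTensor.tmul ((K.normalize l₀).k l) y) := by
  refine eq_of_inner_total (HTensor.total_tmul total_id (HTensor.total_tmul total_id total_id))
    fun p => ?_
  rw [adjoint_inner_right, shiftTensor, comp_apply]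
  change ⟪HTensor.map _ _ (HTensor.assoc _ _ _ (HTensor.tmul p.1 (HTensor.tmul p.2.1 p.2.2))),
    _⟫_ℂ = ⟪HTensor.tmul p.1 (HTensor.tmul p.2.1 p.2.2), _⟫_ℂ
  rw [HTensor.assoc_tmul, HTensor.map_tmul, HTensor.inner_tmul, ← adjoint_inner_right,
    adjoint_shift_k]
  simp only [HTensor.inner_tmul, id_apply, mul_assoc]

/-- Tested on the total vectors k'_l ⊗ y, this is the identity (1 - ⟨β(l), β(μ)⟩)K'(μ, l) = 1
multiplied by a scalar product in 𝓖. -/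
theorem shiftTensor_comp_adjoint_add :
    shiftTensor hK hβ 𝓖 ∘L (shiftTensor hK hβ 𝓖).adjoint +
      HTensor.map (K.normalize l₀).constProj (ContinuousLinearMap.id ℂ 𝓖) =
    ContinuousLinearMap.id ℂ _ := by
  refine ext_of_inner_total (total_k_tmul _ 𝓖) (total_k_tmul _ 𝓖) ?_
  rintro ⟨l, y⟩ ⟨μ, z⟩
  simp only [id]
  rw [add_apply, inner_add_right, inner_comp_adjoint_self, inner_constTensor hK,
    adjoint_shiftTensor_tmul, adjoint_shiftTensor_tmul, id_apply]
  simp only [HTensor.inner_tmul, inner_k_k]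
  linear_combination -⟪z, y⟫_ℂ * hβ.one_sub_mul_normalize hK μ l

variable [CompleteSpace 𝓖]

theorem norm_sq_eq_constTensor_add_shift (h : (K.normalize l₀).space ⊗ₕ 𝓖) :
    ‖h‖ ^ 2 = ‖HTensor.map (K.normalize l₀).constProj (ContinuousLinearMap.id ℂ 𝓖) h‖ ^ 2 +
      ‖(shiftTensor hK hβ 𝓖).adjoint h‖ ^ 2 := by
  have h1 := norm_sq_eq_of_comp_adjoint_add
    (A := HTensor.map (K.normalize l₀).constProj (ContinuousLinearMap.id ℂ 𝓖))
    (B := shiftTensor hK hβ 𝓖) (by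
      rw [adjoint_constTensor, constTensor_comp_self, add_comm,
        shiftTensor_comp_adjoint_add hK hβ]) h
  rwa [adjoint_constTensor] at h1

/-- The norm identity at Qh reads ‖Qh‖² = ‖Qh‖² + ‖R*Qh‖², so R*Q = 0; the claim is the adjoint
relation. -/
theorem constTensor_shiftTensor (v : 𝓑 ⊗ₕ ((K.normalize l₀).space ⊗ₕ 𝓖)) :
    HTensor.map (K.normalize l₀).constProj (ContinuousLinearMap.id ℂ 𝓖)
      (shiftTensor hK hβ 𝓖 v) = 0 := by
  set Q := HTensor.map (K.normalize l₀).constProj (ContinuousLinearMap.id ℂ 𝓖) with hQ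
  refine ext_inner_left ℂ fun h => ?_
  have h1 := norm_sq_eq_constTensor_add_shift hK hβ (Q h)
  have h2 : Q (Q h) = Q h := DFunLike.congr_fun (constTensor_comp_self (K.normalize l₀) 𝓖) h
  rw [← hQ, h2] at h1
  have h3 : (shiftTensor hK hβ 𝓖).adjoint (Q h) = 0 := by
    rw [← norm_eq_zero, ← pow_eq_zero_iff two_ne_zero]; linarith
  have h4 : Q.adjoint = Q := adjoint_constTensor _ _
  rw [← adjoint_inner_left, h4, ← adjoint_inner_left, h3, inner_zero_left, inner_zero_right]

variable [CompleteSpace 𝓑]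

/-- The existence of `B̃` is equivalent to a norm inequality for adjoints. -/
theorem exists_lift_iff {S : Type*} [NormedAddCommGroup S] [InnerProductSpace ℂ S]
    [CompleteSpace S] (D : S →L[ℂ] (K.normalize l₀).space ⊗ₕ 𝓖) :
    (∃ Bt : S →L[ℂ] 𝓑 ⊗ₕ S, ‖Bt‖ ≤ 1 ∧ ∀ x,
      D x = shiftTensor hK hβ 𝓖 (HTensor.map (ContinuousLinearMap.id ℂ 𝓑) D (Bt x)) +
        HTensor.map (K.normalize l₀).constProj (ContinuousLinearMap.id ℂ 𝓖) (D x) ∧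
      ‖Bt x‖ ^ 2 ≤ ‖x‖ ^ 2 -
        ‖HTensor.map (K.normalize l₀).constProj (ContinuousLinearMap.id ℂ 𝓖) (D x)‖ ^ 2) ↔
    ∀ h, ‖D.adjoint h‖ ^ 2 ≤
      ‖HTensor.map (K.normalize l₀).constProj (ContinuousLinearMap.id ℂ 𝓖) h‖ ^ 2 +
      ‖HTensor.map (ContinuousLinearMap.id ℂ 𝓑) D.adjoint
        ((shiftTensor hK hβ 𝓖).adjoint h)‖ ^ 2 := by
  set Q := HTensor.map (K.normalize l₀).constProj (ContinuousLinearMap.id ℂ 𝓖) with hQ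
  set R := shiftTensor hK hβ 𝓖 ∘L HTensor.map (ContinuousLinearMap.id ℂ 𝓑) D with hR
  have hQa : Q.adjoint = Q := adjoint_constTensor _ _
  have hQQ : ∀ x, Q (Q x) = Q x := fun x =>
    DFunLike.congr_fun (constTensor_comp_self (K.normalize l₀) 𝓖) x
  have hRa : ∀ h, R.adjoint h = HTensor.map (ContinuousLinearMap.id ℂ 𝓑) D.adjoint
      ((shiftTensor hK hβ 𝓖).adjoint h) := fun h => by
    rw [hR, adjoint_comp, HTensor.adjoint_map, adjoint_id, comp_apply]
  simp only [← hRa]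
  constructor
  · rintro ⟨Bt, -, hBt⟩ h
    -- The lift is applied at x = D*h. Bounding each scalar product by half the sum of the squared
    -- norms, and using ‖B̃x‖² + ‖QDx‖² ≤ ‖x‖², leaves ‖D*h‖² ≤ ‖R*h‖² + ‖Qh‖², where `R` now
    -- includes the factor I ⊗ D.
    have hip : ⟪h, D (D.adjoint h)⟫_ℂ =
        ⟪R.adjoint h, Bt (D.adjoint h)⟫_ℂ + ⟪Q h, Q (D (D.adjoint h))⟫_ℂ := by
      conv_lhs => rw [(hBt (D.adjoint h)).1]
      rw [inner_add_right, adjoint_inner_left]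
      congr 1
      rw [← hQQ, ← adjoint_inner_left, hQa, hQQ]
    have hn := (hBt (D.adjoint h)).2
    rw [← adjoint_inner_left] at hip
    have hre := congrArg RCLike.re hip
    rw [map_add, inner_self_eq_norm_sq] at hre
    have h2 := norm_sub_sq (𝕜 := ℂ) (R.adjoint h) (Bt (D.adjoint h))
    have h3 := norm_sub_sq (𝕜 := ℂ) (Q h) (Q (D (D.adjoint h)))
    nlinarith [sq_nonneg ‖R.adjoint h - Bt (D.adjoint h)‖,
      sq_nonneg ‖Q h - Q (D (D.adjoint h))‖]
  · intro h
    obtain ⟨W₁, W₂, hW, hD⟩ := exists_column_factorization D Q R (by simpa only [hQa] using h)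
    -- Since Q annihilates the range of `R`, the factorisation D = QW₁ + RW₂ is the required
    -- relation with B̃ = W₂, and ‖QDx‖ ≤ ‖W₁x‖ yields the norm bound.
    have hQD : ∀ x, Q (D x) = Q (W₁ x) := fun x => by
      rw [hD, map_add, hQQ, hR, comp_apply, constTensor_shiftTensor hK hβ, add_zero]
    have hQn : ∀ x, ‖Q x‖ ^ 2 ≤ ‖x‖ ^ 2 := fun x => by
      have := norm_sq_eq_constTensor_add_shift hK hβ x
      rw [this]
      exact le_add_of_nonneg_right (sq_nonneg _)
    refine ⟨W₂, opNorm_le_bound _ zero_le_one fun x => ?_, fun x => ⟨?_, ?_⟩⟩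
    · rw [one_mul]
      refine (sq_le_sq₀ (norm_nonneg _) (norm_nonneg _)).1 ?_
      nlinarith [hW x, sq_nonneg ‖W₁ x‖]
    · rw [hQD, add_comm]
      exact hD x
    · rw [hQD]
      linarith [hW x, hQn (W₁ x)]

end Shift

/-! ### Multipliers and the normalization -/

section Normalize

variable {K : PosKernel Λ} (hK : K.IsPick) (l₀ : Λ)

theorem omega_k (l : Λ) :
    omega hK l₀ (K.k l) = conj (K.delta l₀ l) • (K.normalize l₀).k l := by
  refine ext_inner_right ℂ fun f => ?_
  obtain ⟨g, rfl⟩ := (omega hK l₀).surjective f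
  rw [LinearIsometryEquiv.inner_map_map, inner_smul_left, inner_k, inner_k, omega_apply,
    Complex.conj_conj, mul_div_cancel₀ _ (hK.delta_ne_zero l₀ l)]

variable {𝓖 : Type*} [NormedAddCommGroup 𝓖] [InnerProductSpace ℂ 𝓖]

theorem congrLeft_omega_tmul (l : Λ) (y : 𝓖) :
    HTensor.congrLeft (omega hK l₀) 𝓖 (HTensor.tmul (K.k l) y) =
      conj (K.delta l₀ l) • HTensor.tmul ((K.normalize l₀).k l) y := by
  rw [HTensor.congrLeft_tmul, omega_k, HTensor.smul_tmul]

end Normalize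

/-! ### Multipliers and the inequality for D* -/

section Multiplier

variable {𝓑 𝓖 𝓖' S : Type*} [NormedAddCommGroup 𝓑] [InnerProductSpace ℂ 𝓑] [CompleteSpace 𝓑]
  [NormedAddCommGroup 𝓖] [InnerProductSpace ℂ 𝓖] [CompleteSpace 𝓖]
  [NormedAddCommGroup 𝓖'] [InnerProductSpace ℂ 𝓖'] [CompleteSpace 𝓖']
  [NormedAddCommGroup S] [InnerProductSpace ℂ S] [CompleteSpace S]
  {K : PosKernel Λ} (hK : K.IsPick) {l₀ : Λ} {β : Λ → 𝓑} (hβ : K.IsPickFunction l₀ β)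
  (D : S →L[ℂ] (K.normalize l₀).space ⊗ₕ 𝓖)

theorem norm_sq_adjoint_le_of_multiplier
    (T : (K.normalize l₀).space ⊗ₕ 𝓖 →L[ℂ] (K.normalize l₀).space ⊗ₕ 𝓖') (g : Λ → 𝓖 → 𝓖')
    (hT : ∀ l y, T (HTensor.tmul ((K.normalize l₀).k l) y) =
      HTensor.tmul ((K.normalize l₀).k l) (g l y))
    (hTD : T.adjoint ∘L T + D ∘L D.adjoint = ContinuousLinearMap.id ℂ _)
    (h : (K.normalize l₀).space ⊗ₕ 𝓖) :
    ‖D.adjoint h‖ ^ 2 ≤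
      ‖HTensor.map (K.normalize l₀).constProj (ContinuousLinearMap.id ℂ 𝓖) h‖ ^ 2 +
      ‖HTensor.map (ContinuousLinearMap.id ℂ 𝓑) D.adjoint
        ((shiftTensor hK hβ 𝓖).adjoint h)‖ ^ 2 := by
  have hTD' : T.adjoint ∘L T.adjoint.adjoint + D ∘L D.adjoint =
      ContinuousLinearMap.id ℂ _ := by rwa [adjoint_adjoint]
  have h1 := norm_sq_eq_of_comp_adjoint_add hTD' h
  -- The identity T*T + DD* = I is tensored with the identity of 𝓑 and evaluated at R*h.
  have h2 := norm_sq_eq_of_comp_adjoint_add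
    (A := HTensor.map (ContinuousLinearMap.id ℂ 𝓑) T.adjoint)
    (B := HTensor.map (ContinuousLinearMap.id ℂ 𝓑) D) (by
      rw [HTensor.adjoint_map, HTensor.adjoint_map, HTensor.map_comp, HTensor.map_comp,
        adjoint_id, ContinuousLinearMap.id_comp, ← HTensor.map_add_right, hTD', HTensor.map_id])
    ((shiftTensor hK hβ 𝓖).adjoint h)
  rw [HTensor.adjoint_map, HTensor.adjoint_map, adjoint_id, adjoint_adjoint] at h2
  rw [adjoint_adjoint] at h1
  -- T acts only on the second factor of k'_l ⊗ y, while R* only attaches β(l) in front.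
  have h3 : HTensor.map (ContinuousLinearMap.id ℂ 𝓑) T ∘L (shiftTensor hK hβ 𝓖).adjoint =
      (shiftTensor hK hβ 𝓖').adjoint ∘L T := by
    refine ext_of_total (total_k_tmul _ 𝓖) fun p => ?_
    rw [comp_apply, comp_apply, adjoint_shiftTensor_tmul, hT, adjoint_shiftTensor_tmul,
      HTensor.map_tmul, hT, id_apply]
  have h4 : HTensor.map (ContinuousLinearMap.id ℂ 𝓑) T ((shiftTensor hK hβ 𝓖).adjoint h) =
      (shiftTensor hK hβ 𝓖').adjoint (T h) := DFunLike.congr_fun h3 h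
  have h5 := norm_sq_eq_constTensor_add_shift hK hβ h
  have h6 := norm_sq_eq_constTensor_add_shift hK hβ (T h)
  rw [h4] at h2
  linarith [sq_nonneg ‖HTensor.map (K.normalize l₀).constProj
    (ContinuousLinearMap.id ℂ 𝓖') (T h)‖]

theorem exists_multiplier_of_norm_sq_adjoint_le
    (h : ∀ h, ‖D.adjoint h‖ ^ 2 ≤
      ‖HTensor.map (K.normalize l₀).constProj (ContinuousLinearMap.id ℂ 𝓖) h‖ ^ 2 +
      ‖HTensor.map (ContinuousLinearMap.id ℂ 𝓑) D.adjoint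
        ((shiftTensor hK hβ 𝓖).adjoint h)‖ ^ 2) :
    ∃ (Z : (K.normalize l₀).space ⊗ₕ 𝓖 →L[ℂ] (K.normalize l₀).space ⊗ₕ 𝓖)
      (T : (K.normalize l₀).space ⊗ₕ 𝓖 →L[ℂ]
        (K.normalize l₀).space ⊗ₕ ((K.normalize l₀).space ⊗ₕ 𝓖)),
      (∀ l y, T (HTensor.tmul ((K.normalize l₀).k l) y) =
        HTensor.tmul ((K.normalize l₀).k l) (Z (HTensor.tmul ((K.normalize l₀).k l) y))) ∧
      T.adjoint ∘L T + D ∘L D.adjoint = ContinuousLinearMap.id ℂ _ := by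
  set Q := HTensor.map (K.normalize l₀).constProj (ContinuousLinearMap.id ℂ 𝓖) with hQ
  let A : (K.normalize l₀).space ⊗ₕ 𝓖 →L[ℂ] 𝓑 ⊗ₕ S :=
    HTensor.map (ContinuousLinearMap.id ℂ 𝓑) D.adjoint ∘L (shiftTensor hK hβ 𝓖).adjoint
  have hA : ∀ l y, A (HTensor.tmul ((K.normalize l₀).k l) y) =
      HTensor.tmul (β l) (D.adjoint (HTensor.tmul ((K.normalize l₀).k l) y)) := fun l y => by
    rw [comp_apply, adjoint_shiftTensor_tmul, HTensor.map_tmul, id_apply]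
  have hQQ : Q.adjoint ∘L Q = Q := by
    rw [hQ, adjoint_constTensor, constTensor_comp_self]
  -- The hypothesis is the quadratic form of this operator; its factor `Z` will supply the values of
  -- the multiplier.
  have hY : (Q.adjoint ∘L Q + A.adjoint ∘L A - D ∘L D.adjoint).IsPositive := by
    rw [isPositive_def']
    refine ⟨?_, fun z => ?_⟩
    · rw [isSelfAdjoint_iff']
      simp only [map_add, map_sub, adjoint_comp, adjoint_adjoint]
    · rw [reApplyInnerSelf_apply, inner_re_symm, sub_apply, add_apply, inner_sub_right,
        inner_add_right, inner_adjoint_comp_self, inner_adjoint_comp_self,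
        inner_comp_adjoint_self, map_sub, map_add, inner_self_eq_norm_sq, inner_self_eq_norm_sq,
        inner_self_eq_norm_sq]
      exact sub_nonneg.2 (h z)
  obtain ⟨Z, hZ⟩ := exists_adjoint_comp_self_eq hY
  have hgram : ∀ (μ l : Λ) (z y : 𝓖),
      ⟪HTensor.tmul ((K.normalize l₀).k μ) z, HTensor.tmul ((K.normalize l₀).k l) y⟫_ℂ -
      ⟪HTensor.tmul ((K.normalize l₀).k μ) (Z (HTensor.tmul ((K.normalize l₀).k μ) z)),
        HTensor.tmul ((K.normalize l₀).k l) (Z (HTensor.tmul ((K.normalize l₀).k l) y))⟫_ℂ =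
      ⟪D.adjoint (HTensor.tmul ((K.normalize l₀).k μ) z),
        D.adjoint (HTensor.tmul ((K.normalize l₀).k l) y)⟫_ℂ := by
    intro μ l z y
    rw [HTensor.inner_tmul _ _ (Z _), ← inner_adjoint_comp_self, hZ, hQQ, sub_apply, add_apply,
      inner_sub_right, inner_add_right, inner_constTensor hK, inner_adjoint_comp_self,
      inner_comp_adjoint_self, hA, hA, HTensor.inner_tmul, HTensor.inner_tmul, inner_k_k]
    -- The entry of Z*Z is ⟪z, y⟫ - (1 - ⟪β μ, β l⟫)⟪d_μ, d_l⟫, with d_μ, d_l the images under D*.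
    -- Multiplication by K'(μ, l) removes the Pick factor.
    linear_combination ⟪D.adjoint (HTensor.tmul ((K.normalize l₀).k μ) z),
      D.adjoint (HTensor.tmul ((K.normalize l₀).k l) y)⟫_ℂ * hβ.one_sub_mul_normalize hK μ l
  -- By `hgram` the difference of the two Gram matrices is the Gram matrix of the vectors D*(k'_l ⊗
  -- y), hence positive semidefinite.
  obtain ⟨T, -, hT⟩ := exists_contraction
    (fun p : Λ × 𝓖 => HTensor.tmul ((K.normalize l₀).k p.1) (id p.2))
    (fun p : Λ × 𝓖 => HTensor.tmul ((K.normalize l₀).k p.1)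
      (Z (HTensor.tmul ((K.normalize l₀).k p.1) p.2))) (total_k_tmul _ 𝓖) (by
      convert posSemidef_of_gram fun p : Λ × 𝓖 =>
        D.adjoint (HTensor.tmul ((K.normalize l₀).k p.1) p.2) using 2
      ext p q
      exact hgram p.1 q.1 p.2 q.2)
  have hT' : ∀ l y, T (HTensor.tmul ((K.normalize l₀).k l) y) =
      HTensor.tmul ((K.normalize l₀).k l) (Z (HTensor.tmul ((K.normalize l₀).k l) y)) :=
    fun l y => hT (l, y)
  refine ⟨Z, T, hT', ext_of_inner_total (total_k_tmul _ 𝓖) (total_k_tmul _ 𝓖) ?_⟩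
  rintro ⟨l, y⟩ ⟨μ, z⟩
  simp only [id]
  rw [add_apply, inner_add_right, inner_adjoint_comp_self, inner_comp_adjoint_self, hT', hT',
    ← hgram, id_apply]
  ring

end Multiplier

end PosKernel

/-! ### Transport along Ω -/

namespace ContractiveSubspace

theorem adjoint_incl_image {H H' : Type u} [NormedAddCommGroup H] [InnerProductSpace ℂ H]
    [CompleteSpace H] [NormedAddCommGroup H'] [InnerProductSpace ℂ H'] [CompleteSpace H']
    (N : ContractiveSubspace H) (U : H ≃ₗᵢ[ℂ] H') (z : H) :
    (N.image U).incl.adjoint (U z) = N.toImage U (N.incl.adjoint z) := by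
  refine ext_inner_right ℂ fun x => ?_
  obtain ⟨x, rfl⟩ := (N.toImage U).surjective x
  rw [ContinuousLinearMap.adjoint_inner_left, incl_toImage, LinearIsometryEquiv.inner_map_map,
    LinearIsometryEquiv.inner_map_map, ContinuousLinearMap.adjoint_inner_left]

end ContractiveSubspace

namespace PosKernel

open ContinuousLinearMap

/-- The complement of a multiplier range, described after normalization of the kernel. -/
theorem exists_isComplement_iff {Λ 𝓖 : Type u} [NormedAddCommGroup 𝓖] [InnerProductSpace ℂ 𝓖]
    [CompleteSpace 𝓖] {K : PosKernel Λ} (hK : K.IsPick) (l₀ : Λ)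
    {𝓖' : Type u} [NormedAddCommGroup 𝓖'] [InnerProductSpace ℂ 𝓖'] [CompleteSpace 𝓖']
    (G : Λ → 𝓖' →L[ℂ] 𝓖) (N : ContractiveSubspace (K.space ⊗ₕ 𝓖)) :
    (∃ hG : K.IsContractiveMultiplier G, (multiplierRange hG).IsComplement N) ↔
    ∃ T : (K.normalize l₀).space ⊗ₕ 𝓖 →L[ℂ] (K.normalize l₀).space ⊗ₕ 𝓖',
      (∀ l y, T (HTensor.tmul ((K.normalize l₀).k l) y) =
        HTensor.tmul ((K.normalize l₀).k l) ((G l).adjoint y)) ∧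
      T.adjoint ∘L T +
          (N.image (HTensor.congrLeft (omega hK l₀) 𝓖)).incl ∘L
            (N.image (HTensor.congrLeft (omega hK l₀) 𝓖)).incl.adjoint =
        ContinuousLinearMap.id ℂ _ := by
  set U := HTensor.congrLeft (omega hK l₀) 𝓖 with hU
  set V := HTensor.congrLeft (omega hK l₀) 𝓖' with hV
  have hδ : ∀ l, conj (K.delta l₀ l) ≠ 0 := fun l => by simpa using hK.delta_ne_zero l₀ l
  constructor
  · rintro ⟨hG, hN⟩
    rw [ContractiveSubspace.isComplement_iff, multiplierRange,
      ContractiveSubspace.range_incl_comp_adjoint] at hN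
    let T := (V : K.space ⊗ₕ 𝓖' →L[ℂ] (K.normalize l₀).space ⊗ₕ 𝓖') ∘L (mulOp hG).adjoint ∘L
      (U.symm : (K.normalize l₀).space ⊗ₕ 𝓖 →L[ℂ] K.space ⊗ₕ 𝓖)
    have hT : ∀ z, T (U z) = V ((mulOp hG).adjoint z) := fun z => by simp [T]
    refine ⟨T, fun l y => ?_, ?_⟩
    · have h1 := hT (HTensor.tmul (K.k l) y)
      rw [adjoint_mulOp_tmul, congrLeft_omega_tmul, congrLeft_omega_tmul, map_smul] at h1
      -- Ω introduces the same nonzero factor conj δ(l) on both sides, so K and K' share the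
      -- multiplier G.
      exact smul_right_injective _ (hδ l) h1
    · ext z
      obtain ⟨z, rfl⟩ := U.surjective z
      refine ext_inner_left ℂ fun w => ?_
      obtain ⟨w, rfl⟩ := U.surjective w
      rw [add_apply, inner_add_right, inner_adjoint_comp_self, inner_comp_adjoint_self, hT, hT,
        ContractiveSubspace.adjoint_incl_image, ContractiveSubspace.adjoint_incl_image,
        LinearIsometryEquiv.inner_map_map, LinearIsometryEquiv.inner_map_map,
        ← inner_comp_adjoint_self, ← inner_comp_adjoint_self, ← inner_add_right, ← add_apply, hN,
        id_apply, id_apply, LinearIsometryEquiv.inner_map_map]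
  · rintro ⟨T, hT, hN⟩
    have hTn : ∀ z, ‖T z‖ ≤ ‖z‖ := fun z => by
      have h1 := norm_sq_eq_of_comp_adjoint_add (A := T.adjoint) (B := (N.image U).incl)
        (by rwa [adjoint_adjoint]) z
      rw [adjoint_adjoint] at h1
      refine (sq_le_sq₀ (norm_nonneg _) (norm_nonneg _)).1 ?_
      rw [h1]
      exact le_add_of_nonneg_right (sq_nonneg _)
    let T₀ := (V.symm : (K.normalize l₀).space ⊗ₕ 𝓖' →L[ℂ] K.space ⊗ₕ 𝓖') ∘L T ∘L
      (U : K.space ⊗ₕ 𝓖 →L[ℂ] (K.normalize l₀).space ⊗ₕ 𝓖)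
    have hT₀ : ∀ z, V (T₀ z) = T (U z) := fun z => by simp [T₀]
    have hT₀k : ∀ l y, T₀ (HTensor.tmul (K.k l) y) =
        HTensor.tmul (K.k l) ((G l).adjoint y) := fun l y => V.injective (by
      rw [hT₀, congrLeft_omega_tmul, congrLeft_omega_tmul, map_smul, hT])
    have hG : K.IsContractiveMultiplier G := ⟨T₀, opNorm_le_bound _ zero_le_one fun z => by
      rw [one_mul, ← V.norm_map, hT₀, ← U.norm_map z]
      exact hTn _, hT₀k⟩
    -- `mulOp` is built from a chosen extension, which must coincide with `T₀` because the vectors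
    -- k_l ⊗ y are total.
    have hm : (mulOp hG).adjoint = T₀ := ext_of_total (total_k_tmul K 𝓖) fun p => by
      rw [adjoint_mulOp_tmul, hT₀k]
    refine ⟨hG, ?_⟩
    rw [ContractiveSubspace.isComplement_iff, multiplierRange,
      ContractiveSubspace.range_incl_comp_adjoint]
    ext z
    refine ext_inner_left ℂ fun w => ?_
    rw [add_apply, inner_add_right, inner_comp_adjoint_self, inner_comp_adjoint_self, hm,
      ← LinearIsometryEquiv.inner_map_map V, hT₀, hT₀,
      ← LinearIsometryEquiv.inner_map_map (N.toImage U),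
      ← ContractiveSubspace.adjoint_incl_image, ← ContractiveSubspace.adjoint_incl_image,
      ← inner_adjoint_comp_self, ← inner_comp_adjoint_self, ← inner_add_right, ← add_apply, hN,
      id_apply, id_apply, LinearIsometryEquiv.inner_map_map]

end PosKernel

/-! ### The equivalence -/

theorem mainTheorem3 {Λ 𝓑 𝓖 : Type u}
    [NormedAddCommGroup 𝓑] [InnerProductSpace ℂ 𝓑] [CompleteSpace 𝓑]
    [NormedAddCommGroup 𝓖] [InnerProductSpace ℂ 𝓖] [CompleteSpace 𝓖]
    (K : PosKernel Λ) (hK : K.IsPick) (l₀ : Λ)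
    (β : Λ → 𝓑) (hβ : K.IsPickFunction l₀ β)
    (N : ContractiveSubspace (K.space ⊗ₕ 𝓖)) :
    -- (i)
    (∃ (𝓖' : Type u) (_ : NormedAddCommGroup 𝓖') (_ : InnerProductSpace ℂ 𝓖')
        (_ : CompleteSpace 𝓖') (G : Λ → 𝓖' →L[ℂ] 𝓖) (hG : K.IsContractiveMultiplier G),
        (PosKernel.multiplierRange hG).IsComplement N) ↔
    -- (ii)
    (∃ Bt : (N.image (HTensor.congrLeft (PosKernel.omega hK l₀) 𝓖)).Space →L[ℂ]
          𝓑 ⊗ₕ (N.image (HTensor.congrLeft (PosKernel.omega hK l₀) 𝓖)).Space,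
        ‖Bt‖ ≤ 1 ∧
        ∀ ξ : N.Space,
          let ΩN := N.image (HTensor.congrLeft (PosKernel.omega hK l₀) 𝓖)
          let Ωξ : ΩN.Space := N.toImage (HTensor.congrLeft (PosKernel.omega hK l₀) 𝓖) ξ
          let π' : (K.normalize l₀).space ⊗ₕ 𝓖 →L[ℂ] (K.normalize l₀).space ⊗ₕ 𝓖 :=
            HTensor.map (K.normalize l₀).constProj (ContinuousLinearMap.id ℂ 𝓖)
          ΩN.incl Ωξ =
              PosKernel.shiftTensor hK hβ 𝓖
                (HTensor.map (ContinuousLinearMap.id ℂ 𝓑) ΩN.incl (Bt Ωξ)) +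
              π' (ΩN.incl Ωξ) ∧
          ‖Bt Ωξ‖ ^ 2 ≤ ‖Ωξ‖ ^ 2 - ‖π' (ΩN.incl Ωξ)‖ ^ 2) := by
  have hlift := PosKernel.exists_lift_iff (𝓖 := 𝓖) hK hβ
    (N.image (HTensor.congrLeft (PosKernel.omega hK l₀) 𝓖)).incl
  constructor
  · rintro ⟨𝓖', _, _, _, G, h⟩
    obtain ⟨T, hT, hTD⟩ := (PosKernel.exists_isComplement_iff hK l₀ G N).1 h
    obtain ⟨Bt, hn, hBt⟩ := hlift.2 (PosKernel.norm_sq_adjoint_le_of_multiplier hK hβ _ T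
      (fun l y => (G l).adjoint y) hT hTD)
    exact ⟨Bt, hn, fun ξ => hBt (N.toImage (HTensor.congrLeft (PosKernel.omega hK l₀) 𝓖) ξ)⟩
  · rintro ⟨Bt, hn, hBt⟩
    have h := hlift.1 ⟨Bt, hn,
      (N.toImage (HTensor.congrLeft (PosKernel.omega hK l₀) 𝓖)).surjective.forall.2 hBt⟩
    obtain ⟨Z, T, hT, hTD⟩ := PosKernel.exists_multiplier_of_norm_sq_adjoint_le hK hβ _ h
    -- `J l` is y ↦ k'_l ⊗ y, so G(l)* = Z ∘ J l is a bounded operator and 𝓖' is H(K') ⊗ 𝓖.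
    let J : Λ → 𝓖 →L[ℂ] (K.normalize l₀).space ⊗ₕ 𝓖 := fun l =>
      (HTensor.incl _ _).toContinuousLinearMap ∘L TensorProduct.mkL ℂ _ 𝓖 ((K.normalize l₀).k l)
    refine ⟨_, _, _, inferInstance, fun l => (Z ∘L J l).adjoint,
      (PosKernel.exists_isComplement_iff hK l₀ _ N).2 ⟨T, fun l y => ?_, hTD⟩⟩
    rw [ContinuousLinearMap.adjoint_adjoint]
    exact hT l y
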